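/- For a nonnegative integer $m$ let $P_m$ be the path of length $m$, i.e. the graph with vertices $0,1,\dots,m$ and the $m$ edges $\{k-1,k\}$, $1\le k\le m$. For a positive integer $q$ let $Q_q$ be the $q$-dimensional hypercube, i.e. the graph whose vertices are the $q$-tuples over $\{0,1\}$, two of them being adjacent exactly when they differ in exactly one coordinate. A graph $H$ is said to divide a graph $G$ if there is a collection of subgraphs $H_i$ of $G$, each isomorphic to $H$, such that $E(G)$ is the disjoint union of the edge sets $E(H_i)$. Let $q$ be odd with $0<q<2^{32}$ and let $m\ge 0$ be an integer. Then $P_m$ divides $Q_q$ if and only if $m\le q$ and $m \mid q\cdot 2^{q-1}$. -/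

import Mathlib

/-- The `q`-dimensional hypercube `Q_q`: its vertices are the `q`-tuples over `ℤ/2`, and two
vertices are adjacent when they differ in exactly one coordinate. -/
def hypercube (q : ℕ) : SimpleGraph (Fin q → ZMod 2) where
  Adj x y := ∃! i, x i ≠ y i
  symm := ⟨fun x y h => by simpa only [ne_comm] using h⟩
  loopless := ⟨fun x h => by
    obtain ⟨i, hi, _⟩ := h
    exact hi rfl⟩

/-- The path `P_m` of length `m`: it has vertices `0, 1, …, m` and exactly `m` edges, joining
consecutive vertices. -/
abbrev pathOfLength (m : ℕ) : SimpleGraph (Fin (m + 1)) :=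
  SimpleGraph.pathGraph (m + 1)

/-- `H` divides `G`: there is a collection of subgraphs of `G`, each isomorphic to `H`, whose edge
sets are pairwise disjoint and have union `E(G)`. -/
def GraphDivides {W V : Type*} (H : SimpleGraph W) (G : SimpleGraph V) : Prop :=
  ∃ S : Set G.Subgraph,
    (∀ K ∈ S, Nonempty (K.coe ≃g H)) ∧
    S.PairwiseDisjoint SimpleGraph.Subgraph.edgeSet ∧
    ⋃ K ∈ S, K.edgeSet = G.edgeSet

/-!
Necessity is a count. The number of paths times `m` is the number `q * 2 ^ (q - 1)` of edges, and
since all degrees of `Q_q` are odd, each of the `2 ^ q` vertices is an end of some path, so that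
`m ≤ q` (`le_and_dvd_of_graphDivides`).

For sufficiency write `m = d * n` with `d` odd and `n = 2 ^ k`. Then `d` divides `q`, and
`n ≤ r` for `q = d * r`.

*Stretching.* For odd `d`, the cube `Q_d` is an edge-disjoint union of paths of length `d` that join
the even vertices to their antipodes. Taking products, `Q_{d r}` is an edge-disjoint union of copies
of `Q_r` in which every edge is replaced by a path of length `d`. So a decomposition of `Q_r` into
paths of length `n` gives one of `Q_{d r}` into paths of length `d * n`
(`PathDecomposable.stretch`).

*Powers of two.* It remains to decompose `Q_r`, for odd `r ≥ n = 2 ^ k`, into paths of length `n`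
(`pathDecomposable_cube_two_pow`). This is trivial for `k = 0`. Otherwise let `B` be the power of
two with `k < B ≤ 2 * k`. By Ringel's theorem `Q_B` is a union of `B / 2` Hamiltonian cycles
(`nonempty_cycleDecomposition_cube`). As `n` divides their length `2 ^ B`, they can be cut into arcs
of length `n`, so copies of `Q_B` can be split off from `Q_r` until `r = A + B` with `A < n`. Then
`n = A + 2 * j + 1` for some `j < B / 2` with `j ≤ A`. In `Q_A □ Q_B`
(`CycleDecomposition.pathDecomposable_boxProd`), run from each vertex `(y, z)` with `y` even a path
that flips the `A` coordinates of `y` one after the other. For `i < j`, it performs the flip number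
`i`, counted from `0`, not at `z` but at the successor of `z` on the cycle number `i + 1`, stepping
there before the flip and back after it. These paths have length `A + 2 * j = n - 1`, and they use
all edges in the directions of `Q_A` and all edges of the cycles `1, …, j` exactly once. The path
from `(y, z)` ends at `(y + 1, z)`, where `y + 1` is the antipode of `y`, and is odd. Cut the cycle
number `0` into arcs of length `2 * n`. The second halves of the arcs are paths of length `n`, and
the edges of the first halves lengthen the comb paths by one: the arcs are shifted by `n` in the
copies of `Q_B` at odd `y`, so exactly one end of each comb path lies in a first half. The cycles
with numbers above `j` are cut into arcs of length `n`.
-/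

/-! ### Decompositions of edge sets into paths -/

/-- `F` is the edge set of a path of length `m`, given by its sequence of vertices
`p 0, …, p m`; the values of `p` beyond `m` are irrelevant. -/
def IsPathEdgeSet {V : Type*} (m : ℕ) (F : Set (Sym2 V)) : Prop :=
  ∃ p : ℕ → V, Set.InjOn p (Set.Iic m) ∧ F = {e | ∃ t < m, s(p t, p (t + 1)) = e}

/-- The edge set `E` is a disjoint union of edge sets of paths of length `m`. -/
def PathDecomposable {V : Type*} (m : ℕ) (E : Set (Sym2 V)) : Prop :=
  ∃ S : Set (Set (Sym2 V)), (∀ F ∈ S, IsPathEdgeSet m F) ∧ S.PairwiseDisjoint id ∧ ⋃₀ S = E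

namespace PathDecomposable

variable {V W : Type*} {m : ℕ}

/-- A family of paths decomposes `E` as soon as its edges exhaust `E` and no edge belongs to two
members of the family. -/
theorem of_family {ι : Type*} {E : Set (Sym2 V)} (p : ι → ℕ → V)
    (hinj : ∀ i, Set.InjOn (p i) (Set.Iic m))
    (hmem : ∀ i, ∀ t < m, s(p i t, p i (t + 1)) ∈ E)
    (hex : ∀ e ∈ E, ∃ i, ∃ t < m, s(p i t, p i (t + 1)) = e)
    (huniq : ∀ i i', ∀ t < m, ∀ t' < m,
      s(p i t, p i (t + 1)) = s(p i' t', p i' (t' + 1)) → i = i') :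
    PathDecomposable m E := by
  refine ⟨Set.range fun i => {e | ∃ t < m, s(p i t, p i (t + 1)) = e}, ?_, ?_, ?_⟩
  · rintro _ ⟨i, rfl⟩
    exact ⟨p i, hinj i, rfl⟩
  · rintro _ ⟨i, rfl⟩ _ ⟨i', rfl⟩ hne
    rw [Function.onFun, Set.disjoint_left]
    rintro e ⟨t, ht, rfl⟩ ⟨t', ht', he⟩
    exact hne (by rw [huniq i i' t ht t' ht' he.symm])
  · ext e
    simp only [Set.sUnion_range, Set.mem_iUnion, Set.mem_ofPred_eq]
    constructor
    · rintro ⟨i, t, ht, rfl⟩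
      exact hmem i t ht
    · exact hex e

theorem iUnion {ι : Type*} {E : ι → Set (Sym2 V)} (hE : ∀ i, PathDecomposable m (E i))
    (hdisj : ∀ i i' e, e ∈ E i → e ∈ E i' → i = i') : PathDecomposable m (⋃ i, E i) := by
  choose S hS hSd hSu using hE
  refine ⟨⋃ i, S i, ?_, ?_, ?_⟩
  · simp only [Set.mem_iUnion]
    rintro F ⟨i, hi⟩
    exact hS i F hi
  · intro F hF F' hF' hne
    simp only [Set.mem_iUnion] at hF hF'
    obtain ⟨i, hi⟩ := hF
    obtain ⟨i', hi'⟩ := hF'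
    by_cases h : i = i'
    · subst h
      exact hSd i hi hi' hne
    · rw [Function.onFun, Set.disjoint_left]
      intro e he he'
      exact h (hdisj i i' e (hSu i ▸ ⟨F, hi, he⟩) (hSu i' ▸ ⟨F', hi', he'⟩))
  · rw [Set.sUnion_iUnion]
    exact Set.iUnion_congr hSu

theorem union {E E' : Set (Sym2 V)} (hE : PathDecomposable m E) (hE' : PathDecomposable m E')
    (hdisj : Disjoint E E') : PathDecomposable m (E ∪ E') := by
  rw [Set.union_eq_iUnion]
  refine iUnion (fun b => by cases b <;> assumption) ?_
  rw [Set.disjoint_left] at hdisj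
  rintro (_ | _) (_ | _) e h h'
  · rfl
  · exact (hdisj h' h).elim
  · exact (hdisj h h').elim
  · rfl

theorem map {E : Set (Sym2 V)} (hE : PathDecomposable m E) {φ : V → W}
    (hφ : Function.Injective φ) : PathDecomposable m (Sym2.map φ '' E) := by
  obtain ⟨S, hS, hSd, rfl⟩ := hE
  refine ⟨(fun F => Sym2.map φ '' F) '' S, ?_, ?_, ?_⟩
  · rintro _ ⟨F, hF, rfl⟩
    obtain ⟨p, hp, rfl⟩ := hS F hF
    refine ⟨φ ∘ p, fun a ha b hb h => hp ha hb (hφ h), ?_⟩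
    ext e
    constructor
    · rintro ⟨_, ⟨t, ht, rfl⟩, rfl⟩
      exact ⟨t, ht, rfl⟩
    · rintro ⟨t, ht, rfl⟩
      exact ⟨_, ⟨t, ht, rfl⟩, rfl⟩
  · rintro _ ⟨F, hF, rfl⟩ _ ⟨F', hF', rfl⟩ hne
    have : F ≠ F' := fun h => hne (by rw [h])
    exact (Set.disjoint_image_iff (Sym2.map.injective hφ)).2 (hSd hF hF' this)
  · rw [Set.sUnion_image, Set.sUnion_eq_biUnion, Set.image_iUnion₂]

theorem iso {G : SimpleGraph V} {H : SimpleGraph W} (φ : G ≃g H)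
    (hG : PathDecomposable m G.edgeSet) : PathDecomposable m H.edgeSet := by
  convert hG.map φ.injective
  ext e
  induction e with
  | _ a b =>
    simp only [SimpleGraph.mem_edgeSet, Set.mem_image]
    constructor
    · intro h
      refine ⟨s(φ.symm a, φ.symm b), ?_, by simp⟩
      exact φ.symm.map_adj_iff.2 h
    · rintro ⟨e, he, h⟩
      induction e with
      | _ c d =>
        have h' : s(a, b) = s(φ c, φ d) := by rw [← h]; rfl
        rw [← SimpleGraph.mem_edgeSet, h', SimpleGraph.mem_edgeSet]
        exact φ.map_adj_iff.2 he

/-- Each copy of either factor in a box product can be decomposed separately. -/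
theorem boxProd {G : SimpleGraph V} {H : SimpleGraph W} (hG : PathDecomposable m G.edgeSet)
    (hH : PathDecomposable m H.edgeSet) : PathDecomposable m (G □ H).edgeSet := by
  have h₁ : PathDecomposable m (⋃ z : W, Sym2.map (fun y : V => (y, z)) '' G.edgeSet) := by
    refine iUnion (fun z => hG.map fun a b h => (Prod.mk.inj h).1) ?_
    rintro z z' e ⟨e₁, -, rfl⟩ ⟨e₂, -, h⟩
    induction e₁ with
    | _ a b =>
    induction e₂ with
    | _ c d =>
    simp only [Sym2.map_mk, Sym2.eq_iff, Prod.mk.injEq] at h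
    grind
  have h₂ : PathDecomposable m (⋃ y : V, Sym2.map (fun z : W => (y, z)) '' H.edgeSet) := by
    refine iUnion (fun z => hH.map fun a b h => (Prod.mk.inj h).2) ?_
    rintro z z' e ⟨e₁, -, rfl⟩ ⟨e₂, -, h⟩
    induction e₁ with
    | _ a b =>
    induction e₂ with
    | _ c d =>
    simp only [Sym2.map_mk, Sym2.eq_iff, Prod.mk.injEq] at h
    grind
  convert h₁.union h₂ ?_
  · ext e
    induction e with
    | _ a b =>
    obtain ⟨a, a'⟩ := a
    obtain ⟨b, b'⟩ := b
    simp only [SimpleGraph.mem_edgeSet, SimpleGraph.boxProd_adj, Set.mem_union, Set.mem_iUnion,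
      Set.mem_image]
    constructor
    · rintro (⟨h, rfl⟩ | ⟨h, rfl⟩)
      · exact Or.inl ⟨a', s(a, b), h, rfl⟩
      · exact Or.inr ⟨a, s(a', b'), h, rfl⟩
    · rintro (⟨i, e, he, h⟩ | ⟨i, e, he, h⟩)
      all_goals
        induction e with
        | _ c d =>
        simp only [Sym2.map_mk, Sym2.eq_iff, Prod.mk.injEq] at h
        have he' := he.symm
        simp only [SimpleGraph.mem_edgeSet] at he he'
        grind
  · rw [Set.disjoint_left]
    simp only [Set.mem_iUnion, not_exists]
    rintro _ ⟨z, e₁, he, rfl⟩ y ⟨e₂, he₂, h⟩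
    induction e₁ with
    | _ a b =>
    induction e₂ with
    | _ c d =>
    have := he.ne
    simp only [Sym2.map_mk, Sym2.eq_iff, Prod.mk.injEq] at h
    grind

theorem one (G : SimpleGraph V) : PathDecomposable 1 G.edgeSet := by
  refine of_family (ι := G.edgeSet) (fun e t => if t = 0 then (Quot.out e.1).1 else
    (Quot.out e.1).2) ?_ ?_ ?_ ?_
  all_goals
    have key : ∀ e : Sym2 V, s((Quot.out e).1, (Quot.out e).2) = e := fun e => Quot.out_eq e
  · rintro ⟨e, he⟩ a ha b hb h
    rw [← key e, SimpleGraph.mem_edgeSet] at he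
    have := he.ne
    simp only [Set.mem_Iic] at ha hb
    grind
  · rintro ⟨e, he⟩ t ht
    obtain rfl : t = 0 := by omega
    simpa [key] using he
  · intro e he
    exact ⟨⟨e, he⟩, 0, by simp, by simp [key]⟩
  · rintro ⟨e, he⟩ ⟨e', he'⟩ t ht t' ht' h
    obtain rfl : t = 0 := by omega
    obtain rfl : t' = 0 := by omega
    simpa [key] using h

end PathDecomposable

/-! ### Cycle decompositions -/

/-- If the vertices of `T` carry phases `τ` in `[0, n)` that increase by one along the permutation
`f`, and `T` leaves no phase out, then the edges `{u, f u}` with `u ∈ T` fall apart into arcs of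
length `n`, one for every vertex of phase `0`. -/
theorem PathDecomposable.arcs {V : Type*} {n : ℕ} (f : Equiv.Perm V) (T : Set V) (τ : V → ℕ)
    (hinj : ∀ v, Set.InjOn (fun t => f^[t] v) (Set.Iic n))
    (hedge : ∀ u u', s(u, f u) = s(u', f u') → u = u')
    (hlt : ∀ u ∈ T, τ u < n)
    (hpred : ∀ u ∈ T, τ u ≠ 0 → f.symm u ∈ T ∧ τ (f.symm u) + 1 = τ u)
    (hsucc : ∀ u ∈ T, τ u + 1 < n → f u ∈ T ∧ τ (f u) = τ u + 1) :
    PathDecomposable n {e | ∃ u ∈ T, s(u, f u) = e} := by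
  have hit : ∀ u ∈ T, τ u = 0 → ∀ t < n, f^[t] u ∈ T ∧ τ (f^[t] u) = t := by
    intro u hu h0 t
    induction t with
    | zero => exact fun _ => ⟨hu, h0⟩
    | succ t ih =>
      intro ht
      obtain ⟨h1, h2⟩ := ih (by omega)
      rw [Function.iterate_succ_apply']
      obtain ⟨h3, h4⟩ := hsucc _ h1 (by omega)
      exact ⟨h3, by omega⟩
  refine of_family (ι := {u // u ∈ T ∧ τ u = 0}) (fun u t => f^[t] u.1) (fun u => hinj u.1)
    ?_ ?_ ?_
  · rintro ⟨u, hu, h0⟩ t ht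
    exact ⟨f^[t] u, (hit u hu h0 t ht).1, by simp only [Function.iterate_succ_apply']⟩
  · rintro _ ⟨u, hu, rfl⟩
    have key : ∀ k, ∀ u ∈ T, τ u = k → ∃ u₀, u₀ ∈ T ∧ τ u₀ = 0 ∧ f^[k] u₀ = u := by
      intro k
      induction k with
      | zero => exact fun u hu h => ⟨u, hu, h, rfl⟩
      | succ k ih =>
        intro u hu h
        obtain ⟨h1, h2⟩ := hpred u hu (by omega)
        obtain ⟨u₀, h3, h4, h5⟩ := ih _ h1 (by omega)
        exact ⟨u₀, h3, h4, by rw [Function.iterate_succ_apply', h5, Equiv.apply_symm_apply]⟩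
    obtain ⟨u₀, h1, h2, h3⟩ := key _ u hu rfl
    exact ⟨⟨u₀, h1, h2⟩, τ u, hlt u hu, by simp only [Function.iterate_succ_apply', h3]⟩
  · rintro ⟨u, hu, h0⟩ ⟨u', hu', h0'⟩ t ht t' ht' h
    simp only [Function.iterate_succ_apply'] at h
    have h1 := hedge _ _ h
    have h2 : t = t' := by
      rw [← (hit u hu h0 t ht).2, ← (hit u' hu' h0' t' ht').2, h1]
    subst h2
    exact Subtype.ext ((f.injective.iterate t) h1)

/-- A decomposition of the edge set of `G` into oriented cycles, grouped into spanning families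
indexed by `C`: the permutation `next c` runs along the cycles of the family `c`. The labels
increase by one modulo `M` at each step, so the length of every cycle is a multiple of `M`. -/
structure CycleDecomposition {W : Type*} (G : SimpleGraph W) (C : Type*) (M : ℕ) where
  /-- The successor of a vertex on its cycle in the family `c`. -/
  next : C → Equiv.Perm W
  /-- The position of a vertex, modulo `M`, on its cycle in the family `c`. -/
  label : C → W → ZMod M
  label_next : ∀ c z, label c (next c z) = label c z + 1
  adj : ∀ c z, G.Adj z (next c z)
  exists_eq : ∀ z z', G.Adj z z' → ∃ c, next c z = z' ∨ next c z' = z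
  inj : ∀ c c' z z', s(z, next c z) = s(z', next c' z') → c = c' ∧ z = z'

namespace CycleDecomposition

variable {W W' C C' : Type*} {G : SimpleGraph W} {G' : SimpleGraph W'} {M : ℕ}

theorem label_iterate (D : CycleDecomposition G C M) (c : C) (z : W) (t : ℕ) :
    D.label c ((D.next c)^[t] z) = D.label c z + t := by
  induction t with
  | zero => simp
  | succ t ih => rw [Function.iterate_succ_apply', D.label_next, ih]; push_cast; ring

theorem iterate_injOn (D : CycleDecomposition G C M) (c : C) (z : W) {n : ℕ} (hn : n < M) :
    Set.InjOn (fun t => (D.next c)^[t] z) (Set.Iic n) := by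
  intro a ha b hb h
  have h1 := congrArg (D.label c) h
  simp only [label_iterate, add_right_inj] at h1
  rw [ZMod.natCast_eq_natCast_iff'] at h1
  rw [Set.mem_Iic] at ha hb
  rwa [Nat.mod_eq_of_lt (by omega), Nat.mod_eq_of_lt (by omega)] at h1

/-- Transport along an isomorphism of graphs and a renaming of the families. -/
def map (D : CycleDecomposition G C M) (φ : G ≃g G') (ψ : C ≃ C') :
    CycleDecomposition G' C' M where
  next c := (φ.toEquiv.symm.trans (D.next (ψ.symm c))).trans φ.toEquiv
  label c z := D.label (ψ.symm c) (φ.symm z)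
  label_next c z := by
    have : φ.symm (φ (D.next (ψ.symm c) (φ.symm z))) = D.next (ψ.symm c) (φ.symm z) := by simp
    exact (congrArg _ this).trans (D.label_next _ _)
  adj c z := by
    have := φ.map_adj_iff.2 (D.adj (ψ.symm c) (φ.symm z))
    rwa [RelIso.apply_symm_apply] at this
  exists_eq z z' h := by
    obtain ⟨c, hc⟩ := D.exists_eq _ _ (φ.symm.map_adj_iff.2 h)
    refine ⟨ψ c, hc.imp (fun h => ?_) (fun h => ?_)⟩
    all_goals
      have := congrArg φ h
      rw [RelIso.apply_symm_apply] at this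
      rw [← this]
      simp only [Equiv.trans_apply, Equiv.symm_apply_apply]
      rfl
  inj c c' z z' h := by
    have := congrArg (Sym2.map φ.symm) h
    change s(φ.symm z, φ.symm (φ (D.next (ψ.symm c) (φ.symm z)))) =
      s(φ.symm z', φ.symm (φ (D.next (ψ.symm c') (φ.symm z')))) at this
    rw [RelIso.symm_apply_apply, RelIso.symm_apply_apply] at this
    have h1 := D.inj _ _ _ _ this
    exact ⟨ψ.symm.injective h1.1, φ.symm.injective h1.2⟩

/-- The labels may be reduced modulo a divisor of `M`. -/
def ofDvd (D : CycleDecomposition G C M) {M' : ℕ} (h : M' ∣ M) : CycleDecomposition G C M' where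
  next := D.next
  label c z := ZMod.castHom h (ZMod M') (D.label c z)
  label_next c z := by rw [D.label_next, map_add, map_one]
  adj := D.adj
  exists_eq := D.exists_eq
  inj := D.inj

/-- The staircase in the torus `C_M □ C_M`: move along the first factor, except at the vertices
of the antidiagonal `a + b = -1`, where the second coordinate moves instead. -/
def staircase (f : Equiv.Perm W) (π : W → ZMod M) (hπ : ∀ z, π (f z) = π z + 1) :
    Equiv.Perm (W × W) where
  toFun z := if π z.1 + π z.2 = -1 then (z.1, f z.2) else (f z.1, z.2)
  invFun z := if π z.1 + π z.2 = 0 then (z.1, f.symm z.2) else (f.symm z.1, z.2)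
  left_inv := by
    rintro ⟨x, y⟩
    by_cases h : π x + π y = -1
    · have : π x + (π y + 1) = 0 := by linear_combination h
      simp [h, hπ, this]
    · have : ¬ π x + 1 + π y = 0 := fun h' => h (by linear_combination h')
      simp [h, hπ, this]
  right_inv := by
    rintro ⟨x, y⟩
    have hs : ∀ z, π (f.symm z) = π z - 1 := fun z => by
      rw [eq_sub_iff_add_eq, ← hπ, Equiv.apply_symm_apply]
    by_cases h : π x + π y = 0
    · have : π x + (π y - 1) = -1 := by linear_combination h
      simp [h, hs, this]
    · have : ¬ π x - 1 + π y = -1 := fun h' => h (by linear_combination h')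
      simp [h, hs, this]

/-- The position on a staircase: one turn, of length `M`, for each value of the second label. -/
def staircaseLabel (π : W → ZMod M) (z : W × W) : ZMod (M * M) :=
  ((M * (π z.2).val + (π z.1 + π z.2).val : ℕ) : ZMod (M * M))

theorem _root_.ZMod.val_add_one_cases [NeZero M] (a : ZMod M) :
    (a ≠ -1 ∧ (a + 1).val = a.val + 1) ∨ (a = -1 ∧ (a + 1).val = 0 ∧ a.val + 1 = M) := by
  have hM : M ≠ 0 := NeZero.ne M
  by_cases h : a = -1
  · refine Or.inr ⟨h, by simp [h], ?_⟩
    subst h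
    obtain ⟨k, rfl⟩ := Nat.exists_eq_succ_of_ne_zero hM
    simp [ZMod.val_neg_one]
  · refine Or.inl ⟨h, ?_⟩
    have hlt : a.val ≠ M - 1 := fun h' => h ?_
    · have := a.val_lt
      have h2 : (((a.val + 1 : ℕ) : ZMod M)).val = a.val + 1 := ZMod.val_cast_of_lt (by omega)
      rwa [Nat.cast_add, ZMod.natCast_zmod_val, Nat.cast_one] at h2
    rw [eq_neg_iff_add_eq_zero, ← ZMod.natCast_zmod_val a, h']
    have : ((M - 1 + 1 : ℕ) : ZMod M) = 0 := by
      rw [Nat.sub_add_cancel (by omega)]; simp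
    exact_mod_cast this

theorem staircaseLabel_next [NeZero M] (f : Equiv.Perm W) (π : W → ZMod M)
    (hπ : ∀ z, π (f z) = π z + 1) (z : W × W) :
    staircaseLabel π (staircase f π hπ z) = staircaseLabel π z + 1 := by
  obtain ⟨x, y⟩ := z
  simp only [staircaseLabel, staircase, Equiv.coe_fn_mk]
  rcases ZMod.val_add_one_cases (π x + π y) with ⟨h, h1⟩ | ⟨h, h1, h2⟩
  · have e : π x + 1 + π y = π x + π y + 1 := by ring
    simp only [h, if_false, hπ, e, h1]
    push_cast
    ring
  · have e : π x + (π y + 1) = π x + π y + 1 := by ring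
    simp only [h, if_true, hπ, e]
    rw [← h, h1]
    have h3 : ((π x + π y).val : ZMod (M * M)) + 1 = M := by exact_mod_cast congrArg _ h2
    have h4 : ((M * M : ℕ) : ZMod (M * M)) = 0 := ZMod.natCast_self _
    push_cast at h4 ⊢
    rcases ZMod.val_add_one_cases (π y) with ⟨-, h5⟩ | ⟨-, h5, h6⟩
    · rw [h5]
      push_cast
      linear_combination -h3
    · rw [h5]
      have h6' : ((π y).val : ZMod (M * M)) + 1 = M := by exact_mod_cast congrArg _ h6
      push_cast
      linear_combination -h3 - M * h6' - h4

/-- The product of a cycle family with itself splits into two staircase families, which are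
exchanged by swapping the coordinates. This is Ringel's decomposition of `C_M □ C_M` into two
cycles of length `M * M`. -/
def square [NeZero M] (D : CycleDecomposition G C M) :
    CycleDecomposition (G □ G) (C ⊕ C) (M * M) where
  next := Sum.elim (fun c => staircase (D.next c) (D.label c) (D.label_next c))
    (fun c => ((Equiv.prodComm W W).trans
      (staircase (D.next c) (D.label c) (D.label_next c))).trans (Equiv.prodComm W W))
  label := Sum.elim (fun c => staircaseLabel (D.label c))
    (fun c z => staircaseLabel (D.label c) z.swap)
  label_next := by
    rintro (c | c) z
    · exact staircaseLabel_next _ _ (D.label_next c) _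
    · simpa using staircaseLabel_next (D.next c) (D.label c) (D.label_next c) z.swap
  adj := by
    rintro (c | c) ⟨x, y⟩ <;>
    simp only [Sum.elim_inl, Sum.elim_inr, staircase, Equiv.trans_apply, Equiv.coe_fn_mk,
      Equiv.prodComm_apply, Prod.swap] <;>
    split_ifs <;> simp [SimpleGraph.boxProd_adj, D.adj]
  exists_eq := by
    rintro ⟨x, y⟩ ⟨x', y'⟩ h
    rw [SimpleGraph.boxProd_adj] at h
    simp only [] at h
    simp only [Sum.exists, Sum.elim_inl, Sum.elim_inr, staircase, Equiv.trans_apply,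
      Equiv.coe_fn_mk, Equiv.prodComm_apply, Prod.swap]
    rcases h with ⟨h, rfl⟩ | ⟨h, rfl⟩
    · obtain ⟨c, h | h⟩ := D.exists_eq _ _ h
      · by_cases h' : D.label c y + D.label c x = -1
        · exact Or.inr ⟨c, Or.inl (by simp [h', h])⟩
        · exact Or.inl ⟨c, Or.inl (by rw [add_comm] at h'; simp [h', h])⟩
      · by_cases h' : D.label c y + D.label c x' = -1
        · exact Or.inr ⟨c, Or.inr (by simp [h', h])⟩
        · exact Or.inl ⟨c, Or.inr (by rw [add_comm] at h'; simp [h', h])⟩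
    · obtain ⟨c, h | h⟩ := D.exists_eq _ _ h
      · by_cases h' : D.label c x + D.label c y = -1
        · exact Or.inl ⟨c, Or.inl (by simp [h', h])⟩
        · exact Or.inr ⟨c, Or.inl (by rw [add_comm] at h'; simp [h', h])⟩
      · by_cases h' : D.label c x + D.label c y' = -1
        · exact Or.inl ⟨c, Or.inr (by simp [h', h])⟩
        · exact Or.inr ⟨c, Or.inr (by rw [add_comm] at h'; simp [h', h])⟩
  inj := by
    have hne : ∀ c z, D.next c z ≠ z := fun c z h => (D.adj c z).ne h.symm
    have key : ∀ c c' z z', (z = z' ∧ D.next c z = D.next c' z') ∨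
        (z = D.next c' z' ∧ D.next c z = z') → c = c' ∧ z = z' := fun c c' z z' h =>
      D.inj c c' z z' (Sym2.eq_iff.2 h)
    rintro (c | c) (c' | c') ⟨x, y⟩ ⟨x', y'⟩ h <;>
    simp only [Sum.elim_inl, Sum.elim_inr, staircase, Equiv.trans_apply, Equiv.coe_fn_mk,
      Equiv.prodComm_apply, Prod.swap] at h <;>
    split_ifs at h with h1 h2 h2 <;>
    simp only [Sym2.eq_iff, Prod.mk.injEq] at h <;>
    have k1 := key c c' x x' <;>
    have k2 := key c c' y y' <;>
    have k3 := key c c' x y' <;>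
    have k4 := key c c' y x' <;>
    grind

end CycleDecomposition

/-! ### Hypercubes over arbitrary index types -/

/-- The hypercube with coordinates indexed by `ι`; `hypercube q` is the case `ι = Fin q`. -/
def cube (ι : Type*) : SimpleGraph (ι → ZMod 2) where
  Adj x y := ∃! i, x i ≠ y i
  symm := ⟨fun x y h => by simpa only [ne_comm] using h⟩
  loopless := ⟨fun x h => by
    obtain ⟨i, hi, _⟩ := h
    exact hi rfl⟩

theorem ZMod.ne_iff_eq_add_one (a b : ZMod 2) : a ≠ b ↔ b = a + 1 := by
  revert a b
  decide

namespace cube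

variable {ι ι' : Type*}

theorem adj_iff [DecidableEq ι] {x y : ι → ZMod 2} :
    (cube ι).Adj x y ↔ ∃ i, y = x + Pi.single i 1 := by
  constructor
  · rintro ⟨i, hi, hu⟩
    refine ⟨i, funext fun l => ?_⟩
    by_cases h : l = i
    · subst h
      simpa using (ZMod.ne_iff_eq_add_one _ _).1 hi
    · by_contra hl
      refine h (hu l fun hxy => hl ?_)
      simp [h, hxy]
  · rintro ⟨i, rfl⟩
    refine ⟨i, by simp, fun l hl => ?_⟩
    by_contra h
    simp [h] at hl

/-- Renaming the coordinates. -/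
def congr (e : ι ≃ ι') : cube ι ≃g cube ι' where
  toEquiv := e.arrowCongr (Equiv.refl _)
  map_rel_iff' := by
    intro x y
    change (∃! i, x (e.symm i) ≠ y (e.symm i)) ↔ ∃! i, x i ≠ y i
    exact (e.existsUnique_congr_left (p := fun i => x i ≠ y i)).symm

/-- A cube is the box product of its faces in complementary sets of coordinates. -/
def sum (α β : Type*) : cube (α ⊕ β) ≃g cube α □ cube β where
  toEquiv := Equiv.sumArrowEquivProdArrow α β (ZMod 2)
  map_rel_iff' := by
    classical
    intro x y
    simp only [SimpleGraph.boxProd_adj, adj_iff, Equiv.sumArrowEquivProdArrow, Equiv.coe_fn_mk]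
    constructor
    · rintro (⟨⟨i, hi⟩, h⟩ | ⟨⟨i, hi⟩, h⟩)
      · refine ⟨Sum.inl i, funext fun l => ?_⟩
        rcases l with l | l
        · simpa [Pi.single_apply] using congrFun hi l
        · simpa [Pi.single_apply] using (congrFun h l).symm
      · refine ⟨Sum.inr i, funext fun l => ?_⟩
        rcases l with l | l
        · simpa [Pi.single_apply] using (congrFun h l).symm
        · simpa [Pi.single_apply] using congrFun hi l
    · rintro ⟨i | i, rfl⟩
      · exact Or.inl ⟨⟨i, funext fun l => by simp [Pi.single_apply]⟩, funext fun l => by simp⟩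
      · exact Or.inr ⟨⟨i, funext fun l => by simp [Pi.single_apply]⟩, funext fun l => by simp⟩

/-- `Q_{a+b}` is the box product of `Q_a` and `Q_b`. -/
def finAdd (a b : ℕ) : cube (Fin (a + b)) ≃g cube (Fin a) □ cube (Fin b) :=
  (congr finSumFinEquiv.symm).trans (sum (Fin a) (Fin b))

theorem sum_add_single [Fintype ι] [DecidableEq ι] (x : ι → ZMod 2) (i : ι) :
    ∑ l, (x + Pi.single i 1 : ι → ZMod 2) l = ∑ l, x l + 1 := by
  simp [Finset.sum_add_distrib]

/-- The square `Q_2` is a single cycle of length `4`. -/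
def cycleDecompositionTwo : CycleDecomposition (cube (Fin 2)) Unit 4 where
  next _ :=
    { toFun := fun x => if x 0 = x 1 then ![x 0 + 1, x 1] else ![x 0, x 1 + 1]
      invFun := fun x => if x 0 = x 1 then ![x 0, x 1 + 1] else ![x 0 + 1, x 1]
      left_inv := by decide
      right_inv := by decide }
  label _ x := if x 0 = 0 then (if x 1 = 0 then 0 else 3) else if x 1 = 0 then 1 else 2
  label_next := by decide
  adj := by
    intro _
    simp only [adj_iff]
    decide
  exists_eq := by
    simp only [adj_iff]
    decide
  inj := by decide

end cube

/-- **Ringel's theorem**: for `B` a power of two, `Q_B` decomposes into `B / 2` Hamiltonian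
cycles. Only the fact that the length of each cycle is a multiple of `2 ^ B` is recorded. -/
theorem nonempty_cycleDecomposition_cube (l : ℕ) :
    Nonempty (CycleDecomposition (cube (Fin (2 ^ (l + 1)))) (Fin (2 ^ l)) (2 ^ 2 ^ (l + 1))) := by
  induction l with
  | zero => exact ⟨cube.cycleDecompositionTwo.map (RelIso.refl _) (Equiv.ofUnique Unit (Fin 1))⟩
  | succ l ih =>
    obtain ⟨D⟩ := ih
    have e : 2 ^ (l + 1) + 2 ^ (l + 1) = 2 ^ (l + 1 + 1) := by ring
    have e' : 2 ^ l + 2 ^ l = 2 ^ (l + 1) := by ring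
    refine ⟨(D.square.map ((cube.finAdd _ _).symm.trans (cube.congr (finCongr e)))
      (finSumFinEquiv.trans (finCongr e'))).ofDvd (dvd_of_eq ?_)⟩
    rw [← pow_add, e]

/-! ### Divisibility of graphs by paths -/

theorem graphDivides_of_pathDecomposable {V : Type*} {G : SimpleGraph V} {m : ℕ}
    (h : PathDecomposable m G.edgeSet) : GraphDivides (pathOfLength m) G := by
  obtain ⟨S, hS, hSd, hSu⟩ := h
  -- the subgraph spanned by an edge set `F`
  have hF : ∀ F ∈ S, ∃ K : G.Subgraph, K.edgeSet = F ∧ Nonempty (K.coe ≃g pathOfLength m) := by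
    intro F hF
    obtain ⟨p, hp, hpF⟩ := hS F hF
    have hFG : ∀ e ∈ F, e ∈ G.edgeSet := fun e he => hSu ▸ ⟨F, hF, he⟩
    let K : G.Subgraph :=
      { verts := p '' Set.Iic m
        Adj := fun a b => s(a, b) ∈ F
        adj_sub := fun h => hFG _ h
        edge_vert := by
          intro a b h
          rw [hpF] at h
          obtain ⟨t, ht, h⟩ := h
          rcases Sym2.eq_iff.1 h with ⟨rfl, -⟩ | ⟨-, rfl⟩
          · exact ⟨t, ht.le, rfl⟩
          · exact ⟨t + 1, ht, rfl⟩
        symm := ⟨fun a b h => by rwa [Sym2.eq_swap]⟩ }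
    refine ⟨K, ?_, ⟨RelIso.symm ?_⟩⟩
    · ext e
      induction e with
      | _ a b => rfl
    · refine ⟨Equiv.ofBijective (fun i => ⟨p i, i, Nat.lt_succ_iff.1 i.2, rfl⟩) ⟨?_, ?_⟩, ?_⟩
      · intro i j hij
        exact Fin.ext (hp (Nat.lt_succ_iff.1 i.2) (Nat.lt_succ_iff.1 j.2)
          (congrArg Subtype.val hij))
      · rintro ⟨_, t, ht, rfl⟩
        exact ⟨⟨t, Nat.lt_succ_iff.2 ht⟩, rfl⟩
      · intro i j
        change s(p i, p j) ∈ F ↔ _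
        rw [SimpleGraph.pathGraph_adj, hpF]
        have hi : (i : ℕ) ≤ m := Nat.lt_succ_iff.1 i.2
        have hj : (j : ℕ) ≤ m := Nat.lt_succ_iff.1 j.2
        constructor
        · rintro ⟨t, ht, h⟩
          rcases Sym2.eq_iff.1 h with ⟨h1, h2⟩ | ⟨h1, h2⟩
          · have e1 := hp (Set.mem_Iic.2 ht.le) hi h1
            have e2 := hp (Set.mem_Iic.2 ht) hj h2
            omega
          · have e1 := hp (Set.mem_Iic.2 ht.le) hj h1
            have e2 := hp (Set.mem_Iic.2 ht) hi h2
            omega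
        · rintro (h | h)
          · exact ⟨i, by omega, by rw [h]⟩
          · exact ⟨j, by omega, by rw [h, Sym2.eq_swap]⟩
  choose K hKe hKi using hF
  refine ⟨Set.range fun F : S => K F.1 F.2, ?_, ?_, ?_⟩
  · rintro _ ⟨F, rfl⟩
    exact hKi _ _
  · rintro _ ⟨F, rfl⟩ _ ⟨F', rfl⟩ hne
    rw [Function.onFun, hKe, hKe]
    refine hSd F.2 F'.2 fun h => hne ?_
    rw [Subtype.ext h]
  · rw [Set.biUnion_range]
    simp only [hKe, ← hSu, Set.sUnion_eq_iUnion]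

/-- The number of neighbours of an inner vertex of a path is even. -/
theorem pathOfLength_even_ncard_neighborSet {m : ℕ} (i : Fin (m + 1)) (h0 : i ≠ 0)
    (hm : i ≠ Fin.last m) : Even ((pathOfLength m).neighborSet i).ncard := by
  have h0' : (i : ℕ) ≠ 0 := fun h => h0 (Fin.ext h)
  have hm' : (i : ℕ) ≠ m := fun h => hm (Fin.ext h)
  have hi := i.2
  have : (pathOfLength m).neighborSet i =
      {⟨i - 1, by omega⟩, ⟨i + 1, by omega⟩} := by
    ext j
    simp only [SimpleGraph.mem_neighborSet, SimpleGraph.pathGraph_adj, Set.mem_insert_iff,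
      Set.mem_singleton_iff, Fin.ext_iff]
    omega
  rw [this, Set.ncard_pair (by simp [Fin.ext_iff])]
  exact even_two

theorem pathOfLength_ncard_edgeSet (m : ℕ) : (pathOfLength m).edgeSet.ncard = m := by
  have : (pathOfLength m).edgeSet = Set.range fun i : Fin m => s(i.castSucc, i.succ) := by
    ext e
    induction e with
    | _ a b =>
    simp only [SimpleGraph.mem_edgeSet, SimpleGraph.pathGraph_adj, Set.mem_range, Sym2.eq_iff,
      Fin.ext_iff, Fin.val_castSucc, Fin.val_succ]
    constructor
    · rintro (h | h)
      · exact ⟨⟨a, by omega⟩, Or.inl ⟨rfl, h⟩⟩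
      · exact ⟨⟨b, by omega⟩, Or.inr ⟨rfl, h⟩⟩
    · rintro ⟨i, h⟩
      omega
  rw [this, Set.ncard_range_of_injective]
  · simp
  · intro i j h
    simp only [Sym2.eq_iff, Fin.ext_iff, Fin.val_castSucc, Fin.val_succ] at h
    apply Fin.ext
    omega

theorem Set.ncard_biUnion_finset {ι X : Type*} [Finite X] (s : Finset ι) (f : ι → Set X)
    (h : (s : Set ι).PairwiseDisjoint f) : (⋃ i ∈ s, f i).ncard = ∑ i ∈ s, (f i).ncard := by
  classical
  induction s using Finset.induction_on with
  | empty => simp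
  | insert a s ha ih =>
    rw [Finset.coe_insert] at h
    rw [Finset.set_biUnion_insert, Finset.sum_insert ha, ← ih (h.subset (Set.subset_insert _ _)),
      Set.ncard_union_eq ?_ (Set.toFinite _) (Set.toFinite _)]
    rw [Set.disjoint_iUnion₂_right]
    intro i hi
    exact h (Set.mem_insert _ _) (Set.mem_insert_of_mem _ hi) (by rintro rfl; exact ha hi)

/-- If `N` paths of length `m` decompose a graph in which all degrees are odd, then `N * m` is
the number of edges, and every vertex is one of the `2 * N` ends of the paths. -/
theorem GraphDivides.exists_card {V : Type*} [Fintype V] {G : SimpleGraph V} {m : ℕ}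
    (hodd : ∀ v, Odd (G.neighborSet v).ncard) (h : GraphDivides (pathOfLength m) G) :
    ∃ N : ℕ, N * m = G.edgeSet.ncard ∧ Fintype.card V ≤ 2 * N := by
  classical
  obtain ⟨S, hS, hSd, hSu⟩ := h
  obtain ⟨S, rfl⟩ : ∃ S' : Finset G.Subgraph, S = S' := ⟨(Set.toFinite S).toFinset, by simp⟩
  have φ : ∀ K : S, K.1.coe ≃g pathOfLength m := fun K => (hS K.1 K.2).some
  -- the two ends of a member of the decomposition
  let ends : S → Finset V := fun K => {((φ K).symm 0 : V), ((φ K).symm (Fin.last m) : V)}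
  refine ⟨S.card, ?_, ?_⟩
  · rw [← hSu]
    refine Eq.trans ?_ (Set.ncard_biUnion_finset S _ hSd).symm
    rw [Finset.sum_const_nat]
    intro K hK
    rw [← SimpleGraph.Subgraph.image_coe_edgeSet_coe,
      Set.ncard_image_of_injective _ (Sym2.map.injective Subtype.val_injective),
      ← Nat.card_coe_set_eq, Nat.card_congr (φ ⟨K, hK⟩).mapEdgeSet, Nat.card_coe_set_eq,
      pathOfLength_ncard_edgeSet]
  · have hcover : (Finset.univ : Finset V) ⊆ S.attach.biUnion ends := by
      intro v _
      by_contra hv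
      simp only [Finset.mem_biUnion, Finset.mem_attach, true_and, not_exists] at hv
      have hnb : G.neighborSet v = ⋃ K ∈ S, K.neighborSet v := by
        ext w
        have := Set.ext_iff.1 hSu (s(v, w))
        simpa using this.symm
      have hdisj : (S : Set G.Subgraph).PairwiseDisjoint fun K => K.neighborSet v := by
        intro K hK K' hK' hne
        rw [Function.onFun, Set.disjoint_left]
        intro w hw hw'
        exact Set.disjoint_left.1 (hSd hK hK' hne) (show s(v, w) ∈ K.edgeSet from hw) hw'
      have heven : Even (G.neighborSet v).ncard := by
        rw [hnb, Set.ncard_biUnion_finset S _ hdisj]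
        refine Finset.even_sum _ fun K hK => ?_
        by_cases hvK : v ∈ K.verts
        · have himg : K.neighborSet v = (fun j => ((φ ⟨K, hK⟩).symm j : V)) ''
              (pathOfLength m).neighborSet (φ ⟨K, hK⟩ ⟨v, hvK⟩) := by
            ext w
            simp only [SimpleGraph.Subgraph.mem_neighborSet, Set.mem_image,
              SimpleGraph.mem_neighborSet]
            constructor
            · intro hw
              refine ⟨φ ⟨K, hK⟩ ⟨w, hw.snd_mem⟩, ?_, by simp⟩
              exact (φ ⟨K, hK⟩).map_adj_iff.2 hw
            · rintro ⟨j, hj, rfl⟩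
              have := (φ ⟨K, hK⟩).symm.map_adj_iff.2 hj
              rw [RelIso.symm_apply_apply] at this
              exact this
          rw [himg, Set.ncard_image_of_injective _ fun i j hij =>
            (φ ⟨K, hK⟩).symm.injective (Subtype.val_injective hij)]
          refine pathOfLength_even_ncard_neighborSet _ (fun h0 => ?_) (fun h0 => ?_)
          all_goals
            refine hv ⟨K, hK⟩ ?_
            simp only [ends, Finset.mem_insert, Finset.mem_singleton]
          · exact Or.inl (by rw [← h0]; simp)
          · exact Or.inr (by rw [← h0]; simp)
        · have : K.neighborSet v = ∅ := by
            ext w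
            simp only [SimpleGraph.Subgraph.mem_neighborSet, Set.mem_empty_iff_false, iff_false]
            exact fun hw => hvK hw.fst_mem
          rw [this, Set.ncard_empty]
          exact Even.zero
      exact (Nat.not_even_iff_odd.2 (hodd v)) heven
    calc Fintype.card V = (Finset.univ : Finset V).card := rfl
      _ ≤ (S.attach.biUnion ends).card := Finset.card_le_card hcover
      _ ≤ ∑ K ∈ S.attach, (ends K).card := Finset.card_biUnion_le
      _ ≤ ∑ K ∈ S.attach, 2 := Finset.sum_le_sum fun K _ => Finset.card_le_two
      _ = 2 * S.card := by simp [mul_comm]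

theorem hypercube_ncard_neighborSet (q : ℕ) (x : Fin q → ZMod 2) :
    ((hypercube q).neighborSet x).ncard = q := by
  have : (hypercube q).neighborSet x = Set.range fun i => x + Pi.single i 1 := by
    ext y
    exact cube.adj_iff.trans (by simp [eq_comm])
  rw [this, Set.ncard_range_of_injective]
  · simp
  · intro i i' h
    by_contra hne
    have := congrFun h i
    simp [hne] at this

theorem hypercube_ncard_edgeSet {q : ℕ} (hq : q ≠ 0) :
    (hypercube q).edgeSet.ncard = q * 2 ^ (q - 1) := by
  classical
  have h := (hypercube q).sum_degrees_eq_twice_card_edges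
  have hdeg : ∀ x, (hypercube q).degree x = q := fun x => by
    rw [← SimpleGraph.card_neighborSet_eq_degree, ← Nat.card_eq_fintype_card,
      Nat.card_coe_set_eq, hypercube_ncard_neighborSet]
  simp only [hdeg, Finset.sum_const, Finset.card_univ, Fintype.card_pi, ZMod.card,
    Finset.prod_const, Fintype.card_fin, smul_eq_mul] at h
  rw [← SimpleGraph.coe_edgeFinset, Set.ncard_coe_finset]
  obtain ⟨k, rfl⟩ := Nat.exists_eq_succ_of_ne_zero hq
  simp only [Nat.succ_eq_add_one, Nat.add_sub_cancel] at h ⊢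
  rw [pow_succ] at h
  linarith

/-- The necessary conditions: count the edges, and observe that each of the `2 ^ q` vertices has
odd degree and hence is an end of a path. -/
theorem le_and_dvd_of_graphDivides {q m : ℕ} (hq : Odd q)
    (h : GraphDivides (pathOfLength m) (hypercube q)) : m ≤ q ∧ m ∣ q * 2 ^ (q - 1) := by
  obtain ⟨N, hN, hV⟩ := h.exists_card fun x => by rwa [hypercube_ncard_neighborSet]
  have hq0 : q ≠ 0 := hq.pos.ne'
  rw [hypercube_ncard_edgeSet hq0] at hN
  refine ⟨?_, Dvd.intro_left N hN⟩
  simp only [Fintype.card_pi, ZMod.card, Finset.prod_const, Finset.card_univ,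
    Fintype.card_fin] at hV
  obtain ⟨k, rfl⟩ := Nat.exists_eq_succ_of_ne_zero hq0
  simp only [Nat.succ_eq_add_one, Nat.add_sub_cancel, pow_succ] at hN hV ⊢
  have h2 : 2 ^ k * m ≤ (k + 1) * 2 ^ k := hN ▸ Nat.mul_le_mul_right m (by omega)
  rw [mul_comm (k + 1)] at h2
  exact Nat.le_of_mul_le_mul_left h2 (by positivity)

/-! ### Sequences of flips -/

/-- The vector whose first `k` coordinates are `1` and whose other coordinates are `0`. -/
def flips (A k : ℕ) : Fin A → ZMod 2 := fun i => if (i : ℕ) < k then 1 else 0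

theorem flips_zero (A : ℕ) : flips A 0 = 0 := by
  funext i
  simp [flips]

theorem flips_succ {A k : ℕ} (hk : k < A) :
    flips A (k + 1) = flips A k + Pi.single ⟨k, hk⟩ 1 := by
  funext i
  simp only [flips, Pi.add_apply, Pi.single_apply, Fin.ext_iff]
  rcases lt_trichotomy (i : ℕ) k with h | h | h
  · simp [h, h.ne, h.trans (Nat.lt_succ_self k)]
  · simp [h]
  · simp [h.ne', h.not_gt, show ¬ (i : ℕ) < k + 1 by omega]

theorem sum_flips {A k : ℕ} (hk : k ≤ A) : ∑ i, flips A k i = k := by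
  induction k with
  | zero => simp [flips_zero]
  | succ k ih => rw [flips_succ hk, cube.sum_add_single, ih (by omega)]; push_cast; rfl

/-- The coordinate sum modulo `2`. -/
def parity {A : ℕ} (y : Fin A → ZMod 2) : ZMod 2 := ∑ i, y i

theorem parity_add_single {A : ℕ} (y : Fin A → ZMod 2) (i : Fin A) :
    parity (y + Pi.single i 1) = parity y + 1 :=
  cube.sum_add_single y i

theorem parity_add_flips {A : ℕ} (y : Fin A → ZMod 2) {k : ℕ} (hk : k ≤ A) :
    parity (y + flips A k) = parity y + k := by
  simp only [parity, Pi.add_apply, Finset.sum_add_distrib, sum_flips hk]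

/-- If two even vertices reach the same vertex by flipping initial segments of coordinates, then
the lengths of these segments are congruent modulo `2`. -/
theorem flips_cancel {A : ℕ} {y y' : Fin A → ZMod 2} {k k' : ℕ} (hk : k ≤ A) (hk' : k' ≤ A)
    (hy : parity y = 0) (hy' : parity y' = 0) (h : y + flips A k = y' + flips A k') :
    (k : ZMod 2) = k' := by
  have := congrArg parity h
  simpa only [parity_add_flips _ hk, parity_add_flips _ hk', hy, hy', zero_add] using this

theorem flips_injOn (A : ℕ) : Set.InjOn (flips A) (Set.Iic A) := by
  have key : ∀ k k', k < k' → k' ≤ A → flips A k ≠ flips A k' := by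
    intro k k' h hk' heq
    have := congrFun heq ⟨k, by omega⟩
    simp [flips, h] at this
  intro k hk k' hk' heq
  rcases lt_trichotomy k k' with h | h | h
  · exact (key k k' h hk' heq).elim
  · exact h
  · exact (key k' k h hk heq.symm).elim

theorem add_add_self {ι : Type*} (x a : ι → ZMod 2) : x + a + a = x := by
  funext i
  simp [add_assoc, CharTwo.add_self_eq_zero]

/-! ### The route of a comb path -/

/-- The route of a comb path, as a sequence of states `(k, o)`: `k` is the number of flips made
so far, and `o` tells the position in the second factor, `0` standing for the base vertex `z` and
`i + 1` for its successor on the `i`-th cycle. For `k < j` the flip number `k` is performed after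
a step to the successor on the cycle `k + 1`, which is taken back afterwards; the remaining flips
are performed at the base vertex. -/
def combState (j t : ℕ) : ℕ × ℕ :=
  if t < 3 * j then (t / 3 + (if t % 3 = 2 then 1 else 0), if t % 3 = 0 then 0 else t / 3 + 2)
  else (t - 2 * j, 0)

theorem combState_spec (j t : ℕ) :
    (∃ k < j, t = 3 * k ∧ combState j t = (k, 0)) ∨
    (∃ k < j, t = 3 * k + 1 ∧ combState j t = (k, k + 2)) ∨
    (∃ k < j, t = 3 * k + 2 ∧ combState j t = (k + 1, k + 2)) ∨
    (∃ k, j ≤ k ∧ t = k + 2 * j ∧ combState j t = (k, 0)) := by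
  unfold combState
  by_cases h : t < 3 * j
  · have h3 : t % 3 = 0 ∨ t % 3 = 1 ∨ t % 3 = 2 := by omega
    rcases h3 with h3 | h3 | h3
    · exact Or.inl ⟨t / 3, by omega, by omega, by simp [h, h3]⟩
    · exact Or.inr (Or.inl ⟨t / 3, by omega, by omega, by simp [h, h3]⟩)
    · exact Or.inr (Or.inr (Or.inl ⟨t / 3, by omega, by omega, by simp [h, h3]⟩))
  · exact Or.inr (Or.inr (Or.inr ⟨t - 2 * j, by omega, by omega, by simp [h]⟩))

theorem combState_injective (j : ℕ) : Function.Injective (combState j) := by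
  intro t t' h
  rcases combState_spec j t with ⟨k, h1, h2, h3⟩ | ⟨k, h1, h2, h3⟩ | ⟨k, h1, h2, h3⟩ |
    ⟨k, h1, h2, h3⟩ <;>
  rcases combState_spec j t' with ⟨k', h1', h2', h3'⟩ | ⟨k', h1', h2', h3'⟩ | ⟨k', h1', h2', h3'⟩ |
    ⟨k', h1', h2', h3'⟩ <;>
  · rw [h3, h3', Prod.mk.injEq] at h
    omega

theorem combState_three_mul {j k : ℕ} (hk : k ≤ j) : combState j (3 * k) = (k, 0) := by
  unfold combState
  split_ifs <;> simp <;> omega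

theorem combState_three_mul_add_one {j k : ℕ} (hk : k < j) :
    combState j (3 * k + 1) = (k, k + 2) := by
  unfold combState
  split_ifs <;> simp <;> omega

theorem combState_three_mul_add_two {j k : ℕ} (hk : k < j) :
    combState j (3 * k + 2) = (k + 1, k + 2) := by
  unfold combState
  split_ifs <;> simp <;> omega

theorem combState_add_two_mul {j k : ℕ} (hk : j ≤ k) : combState j (k + 2 * j) = (k, 0) := by
  unfold combState
  split_ifs <;> simp <;> omega

theorem combState_le {j A t : ℕ} (hj : j ≤ A) (ht : t ≤ A + 2 * j) :
    (combState j t).1 ≤ A ∧ (combState j t).2 ≤ j + 1 ∧ (combState j t).2 ≠ 1 := by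
  rcases combState_spec j t with ⟨k, h1, h2, h3⟩ | ⟨k, h1, h2, h3⟩ | ⟨k, h1, h2, h3⟩ |
    ⟨k, h1, h2, h3⟩ <;> rw [h3] <;> simp <;> omega

/-! ### Edges of the product of a cube with a graph that decomposes into cycles -/

/-- The edge from `u` along the first factor in direction `i`. -/
def flipEdge {A : ℕ} {W : Type*} (i : Fin A) (u : (Fin A → ZMod 2) × W) :
    Sym2 ((Fin A → ZMod 2) × W) :=
  s(u, (u.1 + Pi.single i 1, u.2))

theorem flipEdge_symm {A : ℕ} {W : Type*} (i : Fin A) (y : Fin A → ZMod 2) (z : W) :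
    flipEdge i (y + Pi.single i 1, z) = flipEdge i (y, z) := by
  simp only [flipEdge, add_add_self]
  exact Sym2.eq_swap

theorem flipEdge_inj {A : ℕ} {W : Type*} {i i' : Fin A} {u u' : (Fin A → ZMod 2) × W}
    (h : flipEdge i u = flipEdge i' u') :
    i = i' ∧ u.2 = u'.2 ∧ (u.1 = u'.1 ∨ u.1 = u'.1 + Pi.single i 1) := by
  have hs : ∀ x : Fin A → ZMod 2, x + Pi.single i 1 = x + Pi.single i' 1 → i = i' := by
    intro x hx
    by_contra hne
    simpa [hne] using congrFun (add_left_cancel hx) i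
  obtain ⟨y, z⟩ := u
  obtain ⟨y', z'⟩ := u'
  simp only [flipEdge, Sym2.eq_iff, Prod.mk.injEq] at h
  rcases h with ⟨⟨rfl, rfl⟩, h, -⟩ | ⟨⟨rfl, rfl⟩, h, -⟩
  · exact ⟨hs _ h, rfl, Or.inl rfl⟩
  · have h' := congrArg (· + Pi.single i 1) h
    simp only [add_add_self] at h'
    have := hs _ h'.symm
    subst this
    exact ⟨rfl, rfl, Or.inr rfl⟩

namespace CycleDecomposition

variable {W C : Type*} {H : SimpleGraph W} {A n j M : ℕ}

/-- The edge from `u` along the second factor to the successor on the cycle family `c`. -/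
def edge (D : CycleDecomposition H C M) (c : C) (u : (Fin A → ZMod 2) × W) :
    Sym2 ((Fin A → ZMod 2) × W) :=
  s(u, (u.1, D.next c u.2))

theorem edge_inj (D : CycleDecomposition H C M) {c c' : C} {u u' : (Fin A → ZMod 2) × W}
    (h : D.edge c u = D.edge c' u') : c = c' ∧ u = u' := by
  obtain ⟨y, z⟩ := u
  obtain ⟨y', z'⟩ := u'
  simp only [edge, Sym2.eq_iff, Prod.mk.injEq] at h
  have := D.inj c c' z z'
  rw [Sym2.eq_iff] at this
  grind

theorem edge_ne_flipEdge (D : CycleDecomposition H C M) {c : C} {i : Fin A}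
    {u u' : (Fin A → ZMod 2) × W} : D.edge c u ≠ flipEdge i u' := by
  intro h
  have := (D.adj c u.2).ne
  obtain ⟨y, z⟩ := u
  simp only [edge, flipEdge, Sym2.eq_iff, Prod.mk.injEq] at h
  grind

theorem mem_boxProd_edgeSet_iff (D : CycleDecomposition H C M)
    (e : Sym2 ((Fin A → ZMod 2) × W)) :
    e ∈ (cube (Fin A) □ H).edgeSet ↔ (∃ i u, flipEdge i u = e) ∨ ∃ c u, D.edge c u = e := by
  induction e with
  | _ a b =>
  obtain ⟨y, z⟩ := a
  obtain ⟨y', z'⟩ := b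
  simp only [SimpleGraph.mem_edgeSet, SimpleGraph.boxProd_adj]
  constructor
  · rintro (⟨h, rfl⟩ | ⟨h, rfl⟩)
    · obtain ⟨i, rfl⟩ := cube.adj_iff.1 h
      exact Or.inl ⟨i, (y, z), rfl⟩
    · obtain ⟨c, rfl | rfl⟩ := D.exists_eq _ _ h
      · exact Or.inr ⟨c, (y, z), rfl⟩
      · exact Or.inr ⟨c, (y, z'), Sym2.eq_swap⟩
  · have hA : ∀ (i : Fin A) x, (cube (Fin A)).Adj x (x + Pi.single i 1) :=
      fun i x => cube.adj_iff.2 ⟨i, rfl⟩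
    rintro (⟨i, ⟨x, w⟩, h⟩ | ⟨c, ⟨x, w⟩, h⟩)
    · simp only [flipEdge, Sym2.eq_iff, Prod.mk.injEq] at h
      rcases h with ⟨⟨rfl, rfl⟩, rfl, rfl⟩ | ⟨⟨rfl, rfl⟩, rfl, rfl⟩
      · exact Or.inl ⟨hA _ _, rfl⟩
      · exact Or.inl ⟨(hA _ _).symm, rfl⟩
    · simp only [edge, Sym2.eq_iff, Prod.mk.injEq] at h
      rcases h with ⟨⟨rfl, rfl⟩, rfl, rfl⟩ | ⟨⟨rfl, rfl⟩, rfl, rfl⟩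
      · exact Or.inr ⟨D.adj _ _, rfl⟩
      · exact Or.inr ⟨(D.adj _ _).symm, rfl⟩

/-- The position of `u` on the special cycle `c`, shifted by half a period at the vertices with
odd first component. -/
def phase (D : CycleDecomposition H C (2 * n)) (c : C) (u : (Fin A → ZMod 2) × W) :
    ZMod (2 * n) :=
  D.label c u.2 + if ∑ i, u.1 i = 0 then 0 else (n : ZMod (2 * n))

theorem phase_next (D : CycleDecomposition H C (2 * n)) (c : C) (y : Fin A → ZMod 2) (z : W) :
    D.phase c (y, D.next c z) = D.phase c (y, z) + 1 := by
  simp only [phase, D.label_next]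
  ring

/-- The vertices in the first half of a period of the special cycle. -/
def firstHalf (D : CycleDecomposition H C (2 * n)) (c : C) : Set ((Fin A → ZMod 2) × W) :=
  {u | (D.phase c u).val < n}

theorem _root_.ZMod.val_add_half_lt_iff (hn : n ≠ 0) (a : ZMod (2 * n)) :
    (a + n).val < n ↔ ¬ a.val < n := by
  have : NeZero (2 * n) := ⟨by omega⟩
  have h1 : (n : ZMod (2 * n)).val = n := ZMod.val_cast_of_lt (by omega)
  have h2 := a.val_lt
  rw [ZMod.val_add, h1]
  by_cases h : a.val < n
  · rw [Nat.mod_eq_of_lt (by omega)]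
    omega
  · rw [Nat.mod_eq_sub_mod (by omega), Nat.mod_eq_of_lt (by omega)]
    omega

/-- Flipping an odd number of coordinates exchanges the two halves of the period. -/
theorem mem_firstHalf_add_iff (D : CycleDecomposition H C (2 * n)) (hn : n ≠ 0) (c : C)
    (y a : Fin A → ZMod 2) (ha : ∑ i, a i = 1) (z : W) :
    (y + a, z) ∈ D.firstHalf c ↔ (y, z) ∉ D.firstHalf c := by
  have hsum : ∑ i, (y + a) i = ∑ i, y i + 1 := by simp [Finset.sum_add_distrib, ha]
  have h2 : (n : ZMod (2 * n)) + n = 0 := by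
    have := ZMod.natCast_self (2 * n)
    push_cast at this
    linear_combination this
  simp only [firstHalf, Set.mem_ofPred_eq, phase, hsum]
  have h01 : ∀ b : ZMod 2, b = 0 ∨ b = 1 := by decide
  have h11 : (1 : ZMod 2) + 1 = 0 := by decide
  rcases h01 (∑ i, y i) with h | h
  · simp [h, ZMod.val_add_half_lt_iff hn]
  · simp only [h, h11, if_true, add_zero, one_ne_zero, if_false, ZMod.val_add_half_lt_iff hn,
      not_not]

/-- The second halves of the periods of a cycle family are arcs of length `n`. -/
theorem pathDecomposable_secondHalf (D : CycleDecomposition H C (2 * n)) (hn : 1 < n) (c : C) :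
    PathDecomposable n
      {e | ∃ u : (Fin A → ZMod 2) × W, u ∈ (D.firstHalf c)ᶜ ∧ D.edge c u = e} := by
  have : NeZero (2 * n) := ⟨by omega⟩
  let f : Equiv.Perm ((Fin A → ZMod 2) × W) := Equiv.prodCongr (Equiv.refl _) (D.next c)
  have hph : ∀ u, D.phase c (f u) = D.phase c u + 1 := fun u => D.phase_next c u.1 u.2
  have hph' : ∀ u, D.phase c u = D.phase c (f.symm u) + 1 := fun u => by
    rw [← hph, Equiv.apply_symm_apply]
  refine PathDecomposable.arcs f _ (fun u => (D.phase c u).val - n) ?_ ?_ ?_ ?_ ?_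
  · rintro ⟨y, z⟩ a ha b hb h
    have hit : ∀ t, f^[t] (y, z) = (y, (D.next c)^[t] z) := by
      intro t
      induction t with
      | zero => rfl
      | succ t ih => rw [Function.iterate_succ_apply', ih, Function.iterate_succ_apply']; rfl
    simp only [hit, Prod.mk.injEq, true_and] at h
    exact D.iterate_injOn c z (by omega : n < 2 * n) ha hb h
  · intro u u' h
    exact (D.edge_inj (c := c) (c' := c) h).2
  · intro u hu
    have := (D.phase c u).val_lt
    omega
  · intro u hu h
    simp only [firstHalf, Set.mem_compl_iff, Set.mem_ofPred_eq] at hu ⊢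
    rw [hph'] at hu h
    rw [hph' u]
    rcases ZMod.val_add_one_cases (D.phase c (f.symm u)) with ⟨-, h2⟩ | ⟨-, h2, -⟩ <;> omega
  · intro u hu h
    simp only [firstHalf, Set.mem_compl_iff, Set.mem_ofPred_eq] at hu ⊢
    rw [hph]
    rcases ZMod.val_add_one_cases (D.phase c u) with ⟨-, h2⟩ | ⟨-, -, h2⟩ <;> omega

/-- A whole cycle family splits into arcs of length `n`. -/
theorem pathDecomposable_cycle (D : CycleDecomposition H C (2 * n)) (hn : 1 < n) (c : C) :
    PathDecomposable n {e | ∃ u ∈ Set.univ, s(u, D.next c u) = e} := by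
  have hn0 : NeZero n := ⟨by omega⟩
  let D' := D.ofDvd (Dvd.intro_left 2 rfl : n ∣ 2 * n)
  have hl : ∀ u, D'.label c (D.next c u) = D'.label c u + 1 := D'.label_next c
  have hl' : ∀ u, D'.label c u = D'.label c ((D.next c).symm u) + 1 := fun u => by
    rw [← hl, Equiv.apply_symm_apply]
  refine PathDecomposable.arcs (D.next c) _ (fun u => (D'.label c u).val) ?_ ?_ ?_ ?_ ?_
  · exact fun z => D.iterate_injOn c z (by omega)
  · exact fun u u' h => (D.inj c c u u' h).2
  · exact fun u _ => (D'.label c u).val_lt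
  · intro u _ h
    refine ⟨trivial, ?_⟩
    rw [hl'] at h
    rw [hl' u]
    rcases ZMod.val_add_one_cases (D'.label c ((D.next c).symm u)) with ⟨-, h2⟩ | ⟨-, h2, -⟩ <;>
      omega
  · intro u _ h
    refine ⟨trivial, ?_⟩
    rw [hl]
    rcases ZMod.val_add_one_cases (D'.label c u) with ⟨-, h2⟩ | ⟨-, -, h2⟩ <;> omega

theorem pathDecomposable_edge (D : CycleDecomposition H C (2 * n)) (hn : 1 < n) (c : C) :
    PathDecomposable n {e | ∃ u : (Fin A → ZMod 2) × W, D.edge c u = e} := by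
  convert PathDecomposable.iUnion (fun y : Fin A → ZMod 2 =>
    (D.pathDecomposable_cycle hn c).map (φ := fun z => (y, z)) fun a b h => (Prod.mk.inj h).2) ?_
  · ext e
    simp only [Set.mem_iUnion, Set.mem_image, Set.mem_ofPred_eq, Set.mem_univ, true_and]
    constructor
    · rintro ⟨⟨y, z⟩, rfl⟩
      exact ⟨y, _, ⟨z, rfl⟩, rfl⟩
    · rintro ⟨y, _, ⟨z, rfl⟩, rfl⟩
      exact ⟨(y, z), rfl⟩
  · rintro y y' _ ⟨_, ⟨z, -, rfl⟩, rfl⟩ ⟨_, ⟨z', -, rfl⟩, h⟩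
    exact congrArg Prod.fst (D.edge_inj (c := c) (c' := c) (u := (y', z')) (u' := (y, z)) h).2.symm

theorem pathDecomposable (D : CycleDecomposition H C (2 * n)) (hn : 1 < n) :
    PathDecomposable n H.edgeSet := by
  convert PathDecomposable.iUnion (D.pathDecomposable_cycle hn) ?_
  · ext e
    induction e with
    | _ a b =>
    simp only [SimpleGraph.mem_edgeSet, Set.mem_iUnion, Set.mem_ofPred_eq, Set.mem_univ, true_and]
    constructor
    · intro h
      obtain ⟨c, rfl | rfl⟩ := D.exists_eq _ _ h
      · exact ⟨c, a, rfl⟩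
      · exact ⟨c, b, Sym2.eq_swap⟩
    · rintro ⟨c, u, h⟩
      rw [← SimpleGraph.mem_edgeSet, ← h]
      exact D.adj c u
  · rintro c c' _ ⟨u, -, rfl⟩ ⟨u', -, h⟩
    exact (D.inj _ _ _ _ h).1.symm

/-! ### Decomposition of the product into comb paths and arcs -/

/-- The vertex in the second factor that belongs to the second entry `o` of a state: the base
vertex for `o = 0`, and its successor on the `i`-th cycle for `o = i + 1`. -/
def reach (D : CycleDecomposition H C (2 * n)) (γ : ℕ → C) (z : W) : ℕ → W
  | 0 => z
  | i + 1 => D.next (γ i) z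

/-- The vertex that belongs to the state `s` of the comb path based at `v`. -/
def place (D : CycleDecomposition H C (2 * n)) (γ : ℕ → C) (v : (Fin A → ZMod 2) × W)
    (s : ℕ × ℕ) : (Fin A → ZMod 2) × W :=
  (v.1 + flips A s.1, D.reach γ v.2 s.2)

theorem reach_injOn (D : CycleDecomposition H C (2 * n)) {γ : ℕ → C}
    (hγ : Set.InjOn γ (Set.Iic j)) (z : W) : Set.InjOn (D.reach γ z) (Set.Iic (j + 1)) := by
  rintro (_ | a) ha (_ | b) hb h
  · rfl
  · exact ((D.adj (γ b) z).ne h).elim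
  · exact ((D.adj (γ a) z).ne h.symm).elim
  · simp only [reach] at h
    rw [hγ (Nat.le_of_succ_le_succ ha) (Nat.le_of_succ_le_succ hb)
      (D.inj (γ a) (γ b) z z (by rw [h])).1]

theorem place_inj (D : CycleDecomposition H C (2 * n)) {γ : ℕ → C}
    (hγ : Set.InjOn γ (Set.Iic j)) (v : (Fin A → ZMod 2) × W) {s s' : ℕ × ℕ}
    (hs : s.1 ≤ A) (hs' : s'.1 ≤ A) (ht : s.2 ≤ j + 1) (ht' : s'.2 ≤ j + 1)
    (h : D.place γ v s = D.place γ v s') : s = s' := by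
  simp only [place, Prod.mk.injEq, add_right_inj] at h
  exact Prod.ext (flips_injOn A hs hs' h.1) (D.reach_injOn hγ v.2 ht ht' h.2)

/-- The vertex in the second factor at which the flip number `k` of a comb path is performed. -/
def station (D : CycleDecomposition H C (2 * n)) (γ : ℕ → C) (j k : ℕ) : Equiv.Perm W :=
  if k < j then D.next (γ (k + 1)) else Equiv.refl W

/-- The edges of the comb path based at `v`: the flips, the steps on the cycle `γ (k + 1)` that
precede and follow the flip number `k < j`, and one extra edge on the special cycle `γ 0`, attached
to the end of the path that lies in the first half of a period. -/
inductive CombEdge (D : CycleDecomposition H C (2 * n)) (γ : ℕ → C) (j : ℕ)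
    (v : (Fin A → ZMod 2) × W) : Sym2 ((Fin A → ZMod 2) × W) → Prop
  | flip (k : Fin A) : CombEdge D γ j v (flipEdge k (v.1 + flips A k, D.station γ j k v.2))
  | tooth (k k' : ℕ) (hk : k < j) (hk' : k' = k ∨ k' = k + 1) :
      CombEdge D γ j v (D.edge (γ (k + 1)) (v.1 + flips A k', v.2))
  | first (hv : v ∈ D.firstHalf (γ 0)) :
      CombEdge D γ j v (D.edge (γ 0) (v.1 + flips A 0, v.2))
  | last (hv : v ∉ D.firstHalf (γ 0)) :
      CombEdge D γ j v (D.edge (γ 0) (v.1 + flips A A, v.2))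

/-- Distinct comb paths whose base vertices have even first components have no common edge. -/
theorem CombEdge.base_unique {D : CycleDecomposition H C (2 * n)} {γ : ℕ → C}
    (hγ : Set.InjOn γ (Set.Iic j)) (hj : j ≤ A) (hA : Odd A)
    {v v' : (Fin A → ZMod 2) × W} {e e' : Sym2 ((Fin A → ZMod 2) × W)}
    (hv : parity v.1 = 0) (hv' : parity v'.1 = 0) (h : CombEdge D γ j v e)
    (h' : CombEdge D γ j v' e') (hee : e = e') : v = v' := by
  obtain ⟨y, z⟩ := v
  obtain ⟨y', z'⟩ := v'
  have hA' : ((A : ℕ) : ZMod 2) = 1 := (ZMod.natCast_eq_one_iff_odd).2 hA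
  have hne : ∀ k < j, γ (k + 1) ≠ γ 0 := fun k hk h =>
    absurd (hγ (Set.mem_Iic.2 hk) (Set.mem_Iic.2 (Nat.zero_le j)) h) (by omega)
  have hne' : ∀ a : ZMod 2, a ≠ a + 1 := by decide
  cases h with
  | flip k =>
    cases h' with
    | flip k' =>
      obtain ⟨rfl, h2, h3⟩ := flipEdge_inj hee
      have h2' : z = z' := (D.station γ j k).injective h2
      subst h2'
      rcases h3 with h3 | h3
      · exact Prod.ext (add_right_cancel h3) rfl
      · have := congrArg parity h3
        simp only [parity_add_single, parity_add_flips _ k.2.le, hv, hv'] at this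
        exact (hne' _ this).elim
    | _ => exact (D.edge_ne_flipEdge hee.symm).elim
  | tooth k k₁ hk hk₁ =>
    cases h' with
    | flip k' => exact (D.edge_ne_flipEdge hee).elim
    | tooth k' k₁' hk' hk₁' =>
      obtain ⟨h1, h2⟩ := D.edge_inj hee
      have h1' := hγ (Set.mem_Iic.2 hk) (Set.mem_Iic.2 hk') h1
      obtain rfl : k = k' := by omega
      simp only [Prod.mk.injEq] at h2
      obtain ⟨h2, rfl⟩ := h2
      have h3 := flips_cancel (by omega) (by omega) hv hv' h2
      have h4 : k₁ = k₁' := by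
        rcases hk₁ with rfl | rfl <;> rcases hk₁' with rfl | rfl
        · rfl
        · exact (hne' _ (h3.trans (Nat.cast_succ _))).elim
        · exact (hne' _ (h3.symm.trans (Nat.cast_succ _))).elim
        · rfl
      subst h4
      exact Prod.ext (add_right_cancel h2) rfl
    | _ => exact (hne k hk (D.edge_inj hee).1).elim
  | _ =>
    cases h' with
    | flip k' => exact (D.edge_ne_flipEdge hee).elim
    | tooth k' k₁' hk' hk₁' => exact (hne k' hk' (D.edge_inj hee).1.symm).elim
    | _ =>
      obtain ⟨h2, rfl⟩ := Prod.mk.inj (D.edge_inj hee).2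
      have h3 := flips_cancel (by omega) (by omega) hv hv' h2
      simp only [hA', Nat.cast_zero, zero_ne_one, one_ne_zero] at h3 <;>
      exact Prod.ext (add_right_cancel h2) rfl

/-- The edges covered by the comb paths: all flips, the cycles `γ 1, …, γ j`, and the first halves
of the periods of `γ 0`. -/
def combEdges (D : CycleDecomposition H C (2 * n)) (γ : ℕ → C) (j : ℕ) :
    Set (Sym2 ((Fin A → ZMod 2) × W)) :=
  {e | (∃ i u, flipEdge i u = e) ∨ (∃ k < j, ∃ u, D.edge (γ (k + 1)) u = e) ∨
    ∃ u ∈ D.firstHalf (γ 0), D.edge (γ 0) u = e}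

theorem CombEdge.mem_combEdges {D : CycleDecomposition H C (2 * n)} {γ : ℕ → C} (hn : n ≠ 0)
    (hA : Odd A) {v : (Fin A → ZMod 2) × W} {e : Sym2 ((Fin A → ZMod 2) × W)}
    (h : CombEdge D γ j v e) : e ∈ D.combEdges γ j := by
  cases h with
  | flip k => exact Or.inl ⟨_, _, rfl⟩
  | tooth k k' hk hk' => exact Or.inr (Or.inl ⟨k, hk, _, rfl⟩)
  | first hv => exact Or.inr (Or.inr ⟨_, by simpa [flips_zero] using hv, rfl⟩)
  | last hv =>
    refine Or.inr (Or.inr ⟨_, (D.mem_firstHalf_add_iff hn _ _ _ ?_ _).2 hv, rfl⟩)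
    rw [sum_flips le_rfl, (ZMod.natCast_eq_one_iff_odd).2 hA]

theorem exists_combEdge (D : CycleDecomposition H C (2 * n)) {γ : ℕ → C} (hn : n ≠ 0)
    (hj : j ≤ A) (hA : Odd A) {e : Sym2 ((Fin A → ZMod 2) × W)}
    (he : e ∈ D.combEdges γ j) : ∃ v, parity v.1 = 0 ∧ CombEdge D γ j v e := by
  have h01 : ∀ b : ZMod 2, b = 0 ∨ b + 1 = 0 := by decide
  have hA' : ((A : ℕ) : ZMod 2) = 1 := (ZMod.natCast_eq_one_iff_odd).2 hA
  rcases he with ⟨i, ⟨y, z⟩, rfl⟩ | ⟨k, hk, ⟨y, z⟩, rfl⟩ | ⟨⟨y, z⟩, hu, rfl⟩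
  · have key : ∀ x, parity (x + flips A i) = 0 →
        ∃ v, parity v.1 = 0 ∧ CombEdge D γ j v (flipEdge i (x, z)) := by
      intro x hx
      refine ⟨(_, (D.station γ j i).symm z), hx, ?_⟩
      have := CombEdge.flip (D := D) (γ := γ) (j := j)
        (v := (x + flips A i, (D.station γ j i).symm z)) i
      simpa only [add_add_self, Equiv.apply_symm_apply] using this
    rcases h01 (parity (y + flips A i)) with h | h
    · exact key y h
    · rw [← flipEdge_symm]
      refine key _ ?_
      rw [add_right_comm, parity_add_single, h]
  · have key : ∀ k', k' = k ∨ k' = k + 1 → parity (y + flips A k') = 0 →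
        ∃ v, parity v.1 = 0 ∧ CombEdge D γ j v (D.edge (γ (k + 1)) (y, z)) := by
      intro k' hk' h
      refine ⟨(_, z), h, ?_⟩
      have := CombEdge.tooth (D := D) (γ := γ) (j := j) (v := (y + flips A k', z)) k k' hk hk'
      simpa only [add_add_self] using this
    rcases h01 (parity (y + flips A k)) with h | h
    · exact key k (Or.inl rfl) h
    · refine key (k + 1) (Or.inr rfl) ?_
      rw [flips_succ (by omega), ← add_assoc, parity_add_single, h]
  · rcases h01 (parity y) with h | h
    · refine ⟨(_, z), h, ?_⟩
      simpa only [flips_zero, add_zero] using CombEdge.first (D := D) (γ := γ) (j := j) hu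
    · refine ⟨(y + flips A A, z), by rw [parity_add_flips _ le_rfl, hA', h], ?_⟩
      have := CombEdge.last (D := D) (γ := γ) (j := j) (v := (y + flips A A, z)) (by
        rw [D.mem_firstHalf_add_iff hn _ _ _ (by rw [sum_flips le_rfl, hA'])]
        exact not_not.2 hu)
      simpa only [add_add_self] using this

open Classical in
/-- The states of the comb path based at `v`, including the extra edge at one of its ends. -/
noncomputable def combRoute (D : CycleDecomposition H C (2 * n)) (γ : ℕ → C) (j : ℕ)
    (v : (Fin A → ZMod 2) × W) (t : ℕ) : ℕ × ℕ :=
  if v ∈ D.firstHalf (γ 0) then (if t = 0 then (0, 1) else combState j (t - 1))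
  else if t = n then (A, 1) else combState j t

theorem combRoute_le (D : CycleDecomposition H C (2 * n)) {γ : ℕ → C} (hj : j ≤ A)
    (hn : n = A + 2 * j + 1) (v : (Fin A → ZMod 2) × W) {t : ℕ} (ht : t ≤ n) :
    (D.combRoute γ j v t).1 ≤ A ∧ (D.combRoute γ j v t).2 ≤ j + 1 := by
  unfold combRoute
  split_ifs
  · simp
  · exact (fun h => ⟨h.1, h.2.1⟩) (combState_le hj (by omega))
  · simp
  · exact (fun h => ⟨h.1, h.2.1⟩) (combState_le hj (by omega))

theorem combRoute_injOn (D : CycleDecomposition H C (2 * n)) {γ : ℕ → C} (hj : j ≤ A)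
    (hn : n = A + 2 * j + 1) (v : (Fin A → ZMod 2) × W) :
    Set.InjOn (D.combRoute γ j v) (Set.Iic n) := by
  intro t ht t' ht' h
  rw [Set.mem_Iic] at ht ht'
  have hne : ∀ t ≤ A + 2 * j, ∀ k, combState j t ≠ (k, 1) := fun t ht k h =>
    (combState_le hj ht).2.2 (by rw [h])
  unfold combRoute at h
  split_ifs at h
  · omega
  · exact (hne _ (by omega) _ h.symm).elim
  · exact (hne _ (by omega) _ h).elim
  · have := combState_injective j h
    omega
  · omega
  · exact (hne _ (by omega) _ h.symm).elim
  · exact (hne _ (by omega) _ h).elim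
  · exact combState_injective j h

/-- The edge between two consecutive vertices of a comb path. -/
def step (D : CycleDecomposition H C (2 * n)) (γ : ℕ → C) (v : (Fin A → ZMod 2) × W)
    (s s' : ℕ × ℕ) : Sym2 ((Fin A → ZMod 2) × W) :=
  s(D.place γ v s, D.place γ v s')

theorem step_swap (D : CycleDecomposition H C (2 * n)) (γ : ℕ → C) (v : (Fin A → ZMod 2) × W)
    (s s' : ℕ × ℕ) : D.step γ v s s' = D.step γ v s' s := Sym2.eq_swap

theorem step_zero_succ (D : CycleDecomposition H C (2 * n)) (γ : ℕ → C)
    (v : (Fin A → ZMod 2) × W) (k i : ℕ) :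
    D.step γ v (k, 0) (k, i + 1) = D.edge (γ i) (v.1 + flips A k, v.2) := rfl

theorem step_flip (D : CycleDecomposition H C (2 * n)) (γ : ℕ → C)
    (v : (Fin A → ZMod 2) × W) {k : ℕ} (hk : k < A) (o : ℕ) :
    D.step γ v (k, o) (k + 1, o) = flipEdge ⟨k, hk⟩ (v.1 + flips A k, D.reach γ v.2 o) := by
  simp only [step, flipEdge, place, flips_succ hk, add_assoc]

theorem combEdge_combState (D : CycleDecomposition H C (2 * n)) {γ : ℕ → C} (hj : j ≤ A)
    (v : (Fin A → ZMod 2) × W) {t : ℕ} (ht : t < A + 2 * j) :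
    CombEdge D γ j v (D.step γ v (combState j t) (combState j (t + 1))) := by
  rcases combState_spec j t with ⟨k, h1, rfl, h3⟩ | ⟨k, h1, rfl, h3⟩ | ⟨k, h1, rfl, h3⟩ |
    ⟨k, h1, rfl, h3⟩ <;> rw [h3]
  · rw [combState_three_mul_add_one h1, step_zero_succ]
    exact CombEdge.tooth k k h1 (Or.inl rfl)
  · rw [combState_three_mul_add_two h1, step_flip D γ v (by omega)]
    have := CombEdge.flip (D := D) (γ := γ) (j := j) (v := v) ⟨k, by omega⟩
    simpa only [station, h1, if_true, reach] using this
  · rw [show 3 * k + 2 + 1 = 3 * (k + 1) by ring, combState_three_mul (by omega), step_swap,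
      step_zero_succ]
    exact CombEdge.tooth k (k + 1) h1 (Or.inr rfl)
  · rw [show k + 2 * j + 1 = k + 1 + 2 * j by ring, combState_add_two_mul (by omega),
      step_flip D γ v (by omega)]
    have := CombEdge.flip (D := D) (γ := γ) (j := j) (v := v) ⟨k, by omega⟩
    simpa only [station, h1.not_gt, if_false, reach, Equiv.refl_apply] using this

theorem combEdge_combRoute (D : CycleDecomposition H C (2 * n)) {γ : ℕ → C} (hj : j ≤ A)
    (hn : n = A + 2 * j + 1) (v : (Fin A → ZMod 2) × W) {t : ℕ} (ht : t < n) :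
    CombEdge D γ j v (D.step γ v (D.combRoute γ j v t) (D.combRoute γ j v (t + 1))) := by
  have h0 : combState j 0 = (0, 0) := combState_three_mul (Nat.zero_le j)
  unfold combRoute
  by_cases hv : v ∈ D.firstHalf (γ 0)
  · simp only [hv, if_true, Nat.add_one_ne_zero, if_false, Nat.add_sub_cancel]
    rcases Nat.eq_zero_or_pos t with rfl | hpos
    · rw [if_pos rfl, h0, step_swap, step_zero_succ]
      exact CombEdge.first hv
    · obtain ⟨t, rfl⟩ := Nat.exists_eq_succ_of_ne_zero hpos.ne'
      simpa using D.combEdge_combState hj v (by omega : t < A + 2 * j)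
  · simp only [hv, if_false, ht.ne]
    by_cases h : t + 1 = n
    · obtain rfl : t = A + 2 * j := by omega
      rw [if_pos h, combState_add_two_mul hj, step_zero_succ]
      exact CombEdge.last hv
    · rw [if_neg h]
      exact D.combEdge_combState hj v (by omega)

theorem exists_combRoute (D : CycleDecomposition H C (2 * n)) {γ : ℕ → C} (hj : j ≤ A)
    (hn : n = A + 2 * j + 1) {v : (Fin A → ZMod 2) × W} {e : Sym2 ((Fin A → ZMod 2) × W)}
    (he : CombEdge D γ j v e) :
    ∃ t < n, D.step γ v (D.combRoute γ j v t) (D.combRoute γ j v (t + 1)) = e := by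
  have h0 : combState j 0 = (0, 0) := combState_three_mul (Nat.zero_le j)
  -- the extra edge at the start shifts the times by one
  have key : ∀ t < A + 2 * j, D.step γ v (combState j t) (combState j (t + 1)) = e →
      ∃ t < n, D.step γ v (D.combRoute γ j v t) (D.combRoute γ j v (t + 1)) = e := by
    rintro t ht rfl
    by_cases hv : v ∈ D.firstHalf (γ 0)
    · refine ⟨t + 1, by omega, ?_⟩
      simp [combRoute, hv]
    · refine ⟨t, by omega, ?_⟩
      simp [combRoute, hv, show t ≠ n by omega, show t + 1 ≠ n by omega]
  cases he with
  | flip k =>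
    by_cases hk : (k : ℕ) < j
    · refine key (3 * k + 1) (by omega) ?_
      rw [combState_three_mul_add_one hk, combState_three_mul_add_two hk, step_flip D γ v k.2]
      simp only [station, hk, if_true, reach]
    · refine key (k + 2 * j) (by omega) ?_
      rw [show (k : ℕ) + 2 * j + 1 = k + 1 + 2 * j by ring, combState_add_two_mul (by omega),
        combState_add_two_mul (by omega), step_flip D γ v k.2]
      simp only [station, hk, if_false, reach, Equiv.refl_apply]
  | tooth k k' hk hk' =>
    rcases hk' with rfl | rfl
    · refine key (3 * k') (by omega) ?_
      rw [combState_three_mul hk.le, combState_three_mul_add_one hk, step_zero_succ]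
    · refine key (3 * k + 2) (by omega) ?_
      rw [show 3 * k + 2 + 1 = 3 * (k + 1) by ring, combState_three_mul (by omega),
        combState_three_mul_add_two hk, step_swap, step_zero_succ]
  | first hv =>
    refine ⟨0, by omega, ?_⟩
    simp only [combRoute, hv, if_true, Nat.add_one_ne_zero, if_false, Nat.add_sub_cancel, h0]
    rw [step_swap, step_zero_succ]
  | last hv =>
    refine ⟨A + 2 * j, by omega, ?_⟩
    simp only [combRoute, hv, if_false, ← hn, if_true, show A + 2 * j ≠ n by omega]
    rw [combState_add_two_mul hj, step_zero_succ]

/-- The comb paths decompose the edges that they cover. -/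
theorem pathDecomposable_combEdges (D : CycleDecomposition H C (2 * n)) {γ : ℕ → C}
    (hγ : Set.InjOn γ (Set.Iic j)) (hj : j ≤ A) (hA : Odd A) (hn : n = A + 2 * j + 1) :
    PathDecomposable n (D.combEdges γ j : Set (Sym2 ((Fin A → ZMod 2) × W))) := by
  refine PathDecomposable.of_family
    (ι := {v : (Fin A → ZMod 2) × W // parity v.1 = 0})
    (fun v t => D.place γ v.1 (D.combRoute γ j v.1 t)) ?_ ?_ ?_ ?_
  · intro v t ht t' ht' h
    have h1 := D.combRoute_le (γ := γ) hj hn v.1 ht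
    have h2 := D.combRoute_le (γ := γ) hj hn v.1 ht'
    exact D.combRoute_injOn hj hn v.1 ht ht' (D.place_inj hγ v.1 h1.1 h2.1 h1.2 h2.2 h)
  · intro v t ht
    exact (D.combEdge_combRoute hj hn v.1 ht).mem_combEdges (by omega) hA
  · intro e he
    obtain ⟨v, hv, hve⟩ := D.exists_combEdge (by omega) hj hA he
    obtain ⟨t, ht, h⟩ := D.exists_combRoute hj hn hve
    exact ⟨⟨v, hv⟩, t, ht, h⟩
  · intro v v' t ht t' ht' h
    exact Subtype.ext ((D.combEdge_combRoute hj hn v.1 ht).base_unique hγ hj hA v.2 v'.2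
      (D.combEdge_combRoute hj hn v'.1 ht') h)

/-- If `H` has a decomposition into cycles whose lengths are multiples of `2 * n`, in at least
`j + 1` spanning families, then `Q_A □ H` decomposes into paths of length `n = A + 2 * j + 1`. -/
theorem pathDecomposable_boxProd (D : CycleDecomposition H C (2 * n)) {γ : ℕ → C}
    (hγ : Set.InjOn γ (Set.Iic j)) (hj : j ≤ A) (hA : Odd A) (hn : n = A + 2 * j + 1) :
    PathDecomposable n (cube (Fin A) □ H).edgeSet := by
  have hn1 : 1 < n := by
    have := hA.pos
    omega
  have h1 := D.pathDecomposable_combEdges hγ hj hA hn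
  have h2 := D.pathDecomposable_secondHalf (A := A) hn1 (γ 0)
  have h3 := PathDecomposable.iUnion
    (fun c : {c // c ∉ γ '' Set.Iic j} => D.pathDecomposable_edge (A := A) hn1 c.1) (by
      rintro c c' _ ⟨u, rfl⟩ ⟨u', h⟩
      exact Subtype.ext (D.edge_inj h).1.symm)
  have hγ0 : ∀ k < j, γ (k + 1) ≠ γ 0 := fun k hk h =>
    absurd (hγ (Set.mem_Iic.2 hk) (Set.mem_Iic.2 (Nat.zero_le j)) h) (by omega)
  convert (h1.union h2 ?_).union h3 ?_
  · ext e
    rw [D.mem_boxProd_edgeSet_iff]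
    simp only [combEdges, Set.mem_union, Set.mem_ofPred_eq, Set.mem_iUnion, Subtype.exists,
      Set.mem_compl_iff]
    constructor
    · rintro (h | ⟨c, u, rfl⟩)
      · exact Or.inl (Or.inl (Or.inl h))
      · by_cases hc : c ∈ γ '' Set.Iic j
        · obtain ⟨_ | k, hk, rfl⟩ := hc
          · by_cases hu : u ∈ D.firstHalf (γ 0)
            · exact Or.inl (Or.inl (Or.inr (Or.inr ⟨u, hu, rfl⟩)))
            · exact Or.inl (Or.inr ⟨u, hu, rfl⟩)
          · exact Or.inl (Or.inl (Or.inr (Or.inl ⟨k, hk, u, rfl⟩)))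
        · exact Or.inr ⟨c, hc, u, rfl⟩
    · rintro (((h | ⟨k, -, u, rfl⟩ | ⟨u, -, rfl⟩) | ⟨u, -, rfl⟩) | ⟨c, -, u, rfl⟩)
      · exact Or.inl h
      all_goals exact Or.inr ⟨_, _, rfl⟩
  · rw [Set.disjoint_left]
    rintro e (⟨i, u, rfl⟩ | ⟨k, hk, u, rfl⟩ | ⟨u, hu, rfl⟩) ⟨u', hu', h⟩
    · exact D.edge_ne_flipEdge h
    · exact hγ0 k hk (D.edge_inj h).1.symm
    · exact hu' ((D.edge_inj h).2 ▸ hu)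
  · rw [Set.disjoint_left]
    rintro e he he'
    simp only [Set.mem_iUnion, Subtype.exists] at he'
    obtain ⟨c, hc, u', rfl⟩ := he'
    have hc' : ∀ k ≤ j, γ k ≠ c := fun k hk h => hc ⟨k, hk, h⟩
    rcases he with (⟨i, u, h⟩ | ⟨k, hk, u, h⟩ | ⟨u, hu, h⟩) | ⟨u, hu, h⟩
    · exact D.edge_ne_flipEdge h.symm
    · exact hc' _ hk (D.edge_inj h).1
    · exact hc' _ (Nat.zero_le j) (D.edge_inj h).1
    · exact hc' _ (Nat.zero_le j) (D.edge_inj h).1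

end CycleDecomposition

/-! ### Paths whose length is a power of two -/

theorem three_mul_le_two_pow_add_two {k : ℕ} (hk : 1 ≤ k) : 3 * k ≤ 2 ^ k + 2 := by
  obtain rfl | hk2 := hk.eq_or_lt
  · norm_num
  · induction k, hk2 using Nat.le_induction with
    | base => norm_num
    | succ k hk2 ih =>
      have h1 := ih (by omega)
      have h2 : 2 ^ 2 ≤ 2 ^ k := Nat.pow_le_pow_right (by norm_num) (by omega)
      rw [pow_succ]
      omega

/-- For odd `r`, the cube `Q_r` decomposes into paths of length `2 ^ k`, provided that this length
is at most `r`. -/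
theorem pathDecomposable_cube_two_pow (k r : ℕ) (hr : Odd r) (hkr : 2 ^ k ≤ r) :
    PathDecomposable (2 ^ k) (cube (Fin r)).edgeSet := by
  obtain rfl | hk := Nat.eq_zero_or_pos k
  · exact PathDecomposable.one _
  -- `2 ^ (l + 1)` is the power of two `B` with `k < B ≤ 2 * k`
  obtain ⟨l, hl1, hl2⟩ : ∃ l, 2 ^ l ≤ k ∧ k < 2 ^ (l + 1) :=
    ⟨Nat.log 2 k, Nat.pow_log_le_self 2 hk.ne', Nat.lt_pow_succ_log_self (by norm_num) k⟩
  obtain ⟨D⟩ := nonempty_cycleDecomposition_cube l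
  have hB : 2 ^ (l + 1) = 2 * 2 ^ l := pow_succ' 2 l
  rw [hB] at hl2
  have D' : CycleDecomposition (cube (Fin (2 * 2 ^ l))) (Fin (2 ^ l)) (2 * 2 ^ k) :=
    hB ▸ D.ofDvd (by rw [← pow_succ', hB]; exact pow_dvd_pow 2 hl2)
  have h3 := three_mul_le_two_pow_add_two hk
  have hkn : 2 * k ≤ 2 ^ k := by
    obtain ⟨k', rfl⟩ := Nat.exists_eq_succ_of_ne_zero hk.ne'
    have := Nat.lt_two_pow_self (n := k')
    rw [Nat.succ_eq_add_one, pow_succ]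
    omega
  have hn : Even (2 ^ k) := (even_two).pow_of_ne_zero hk.ne'
  have hpos : 0 < 2 ^ l := by positivity
  generalize 2 ^ k = n at *
  generalize 2 ^ l = h at *
  induction r using Nat.strong_induction_on with
  | _ r ih =>
  obtain ⟨n', rfl⟩ := hn
  obtain ⟨r', rfl⟩ := hr
  -- split off `Q_B`
  obtain ⟨A, hA⟩ : ∃ A, 2 * r' + 1 = A + 2 * h := ⟨2 * r' + 1 - 2 * h, by omega⟩
  have hAodd : Odd A := ⟨r' - h, by omega⟩
  rw [hA]
  refine PathDecomposable.iso (cube.finAdd A (2 * h)).symm ?_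
  by_cases hbig : n' + n' ≤ A
  · exact PathDecomposable.boxProd (ih A (by omega) hAodd hbig)
      (D'.pathDecomposable (by omega))
  -- here `2 * n' < r < 2 * n' + B`, so that `j < B / 2`; as `3 * B ≤ 4 * n' + 4`, also `j ≤ A`
  · obtain ⟨j, hj⟩ : ∃ j, n' + n' = A + 2 * j + 1 := ⟨n' + h - r' - 1, by omega⟩
    have hjh : j < h := by omega
    refine D'.pathDecomposable_boxProd (γ := fun i => if hi : i < h then ⟨i, hi⟩ else ⟨0, hpos⟩)
      ?_ (by omega) hAodd hj
    intro a ha b hb hab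
    rw [Set.mem_Iic] at ha hb
    simpa [show a < h by omega, show b < h by omega] using hab

/-! ### Stretching paths by an odd factor -/

section Stretch

variable {r d : ℕ}

/-- The embedding with base point `κ` of the grid `{0, …, d} ^ r` into the cube of dimension
`r * d`: in the block `l`, the first `θ l` coordinates of `κ l` are flipped. -/
def gridVertex (κ : Fin r → Fin d → ZMod 2) (θ : Fin r → ℕ) : Fin r × Fin d → ZMod 2 :=
  fun x => κ x.1 x.2 + flips d (θ x.1) x.2

/-- The `j`-th of the `d` edges into which the edge of `Q_r` from `u` in direction `i` is
stretched. The coordinate `u i` is irrelevant. -/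
def stretchedEdge (κ : Fin r → Fin d → ZMod 2) (u : Fin r → ZMod 2) (i : Fin r) (j : ℕ) :
    Sym2 (Fin r × Fin d → ZMod 2) :=
  s(gridVertex κ (Function.update (fun l => d * (u l).val) i j),
    gridVertex κ (Function.update (fun l => d * (u l).val) i (j + 1)))

theorem gridVertex_update_succ (κ : Fin r → Fin d → ZMod 2) (θ : Fin r → ℕ) (i : Fin r) {j : ℕ}
    (hj : j < d) : gridVertex κ (Function.update θ i (j + 1)) =
      gridVertex κ (Function.update θ i j) + Pi.single (i, ⟨j, hj⟩) 1 := by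
  funext ⟨l, b⟩
  by_cases h : l = i
  · subst h
    simp [gridVertex, flips_succ hj, add_assoc, Pi.single_apply]
  · simp [gridVertex, h]

theorem stretchedEdge_eq (κ : Fin r → Fin d → ZMod 2) (u : Fin r → ZMod 2) (i : Fin r) {j : ℕ}
    (hj : j < d) : stretchedEdge κ u i j =
      s(gridVertex κ (Function.update (fun l => d * (u l).val) i j),
        gridVertex κ (Function.update (fun l => d * (u l).val) i j) +
          Pi.single (i, ⟨j, hj⟩) 1) := by
  rw [stretchedEdge, gridVertex_update_succ]

theorem stretchedEdge_congr (κ : Fin r → Fin d → ZMod 2) {u u' : Fin r → ZMod 2} {i : Fin r}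
    (h : ∀ l, l ≠ i → u l = u' l) (j : ℕ) : stretchedEdge κ u i j = stretchedEdge κ u' i j := by
  have : ∀ j, Function.update (fun l => d * (u l).val) i j =
      Function.update (fun l => d * (u' l).val) i j := by
    intro j
    funext l
    by_cases hl : l = i
    · subst hl
      simp
    · simp [hl, h l hl]
  rw [stretchedEdge, stretchedEdge, this, this]

theorem flips_mul_val (d : ℕ) (a : ZMod 2) : flips d (d * a.val) = fun _ => a := by
  funext b
  have h : a = 0 ∨ a = 1 := by
    revert a
    decide
  rcases h with rfl | rfl
  · simp [flips]
  · simp [flips, ZMod.val_one]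

theorem sum_gridVertex (κ : Fin r → Fin d → ZMod 2) (θ : Fin r → ℕ) (l : Fin r)
    (hκ : ∑ b, κ l b = 0) (hθ : θ l ≤ d) : ∑ b, gridVertex κ θ (l, b) = θ l := by
  simp only [gridVertex, Finset.sum_add_distrib, hκ, sum_flips hθ, zero_add]

theorem eq_or_eq_add_single {x y : Fin r → ZMod 2} {i : Fin r} (h : ∀ l, l ≠ i → x l = y l) :
    x = y ∨ x = y + Pi.single i 1 := by
  have h12 : ∀ a b : ZMod 2, a = b ∨ a = b + 1 := by decide
  refine (h12 (x i) (y i)).imp (fun h' => ?_) (fun h' => ?_)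
  all_goals
    funext l
    by_cases hl : l = i
    · subst hl
      simpa using h'
    · simpa [hl] using h l hl

theorem val_le_one (a : ZMod 2) : a.val ≤ 1 := Nat.le_of_lt_succ a.val_lt

theorem natCast_mul_val (hd : Odd d) (a : ZMod 2) : ((d * a.val : ℕ) : ZMod 2) = a := by
  rw [Nat.cast_mul, (ZMod.natCast_eq_one_iff_odd).2 hd, one_mul, ZMod.natCast_zmod_val]

/-- A stretched edge determines its base point and the edge that was stretched. -/
theorem stretchedEdge_inj (hd : Odd d) {κ κ' : Fin r → Fin d → ZMod 2}
    (hκ : ∀ l, ∑ b, κ l b = 0) (hκ' : ∀ l, ∑ b, κ' l b = 0) {u u' : Fin r → ZMod 2}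
    {i i' : Fin r} {j j' : ℕ} (hj : j < d) (hj' : j' < d)
    (h : stretchedEdge κ u i j = stretchedEdge κ' u' i' j') :
    κ = κ' ∧ i = i' ∧ ∀ l, l ≠ i → u l = u' l := by
  rw [stretchedEdge_eq _ _ _ hj, stretchedEdge_eq _ _ _ hj', Sym2.eq_iff] at h
  set X := gridVertex κ (Function.update (fun l => d * (u l).val) i j) with hX
  set X' := gridVertex κ' (Function.update (fun l => d * (u' l).val) i' j') with hX'
  -- the direction of the edge
  have hdir : (i, (⟨j, hj⟩ : Fin d)) = (i', ⟨j', hj'⟩) := by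
    have hs : (Pi.single (i, ⟨j, hj⟩) 1 : Fin r × Fin d → ZMod 2) =
        Pi.single (i', ⟨j', hj'⟩) 1 := by
      rcases h with ⟨h1, h2⟩ | ⟨h1, h2⟩
      · rw [h1] at h2
        exact add_left_cancel h2
      · rw [h1] at h2
        have h3 := congrArg (fun x => x + Pi.single (i, (⟨j, hj⟩ : Fin d)) 1) h2
        simp only [add_add_self] at h3
        exact (add_left_cancel h3).symm
    by_contra hne
    simpa [hne] using congrFun hs (i, ⟨j, hj⟩)
  obtain ⟨rfl, hjj⟩ := Prod.mk.inj hdir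
  obtain rfl : j = j' := congrArg Fin.val hjj
  have hle : ∀ (v : Fin r → ZMod 2) l, Function.update (fun l => d * (v l).val) i j l ≤ d := by
    intro v l
    by_cases hl : l = i
    · subst hl
      simpa using hj.le
    · simp only [Function.update_of_ne hl]
      exact (Nat.mul_le_mul_left d (val_le_one _)).trans_eq (mul_one d)
  have hsum : ∀ l, ∑ b, X (l, b) = (Function.update (fun l => d * (u l).val) i j l : ℕ) :=
    fun l => sum_gridVertex _ _ _ (hκ l) (hle u l)
  have hsum' : ∀ l, ∑ b, X' (l, b) = (Function.update (fun l => d * (u' l).val) i j l : ℕ) :=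
    fun l => sum_gridVertex _ _ _ (hκ' l) (hle u' l)
  -- comparing the coordinate sums of the block `i` excludes the opposite orientation
  have hXX : X = X' := by
    rcases h with ⟨h, -⟩ | ⟨h, -⟩
    · exact h
    · exfalso
      have h1 : ∑ b, X (i, b) = ∑ b, X' (i, b) + 1 := by
        rw [h]
        simp [Finset.sum_add_distrib, Pi.single_apply]
      rw [hsum, hsum', Function.update_self, Function.update_self] at h1
      simp at h1
  have hu : ∀ l, l ≠ i → u l = u' l := by
    intro l hl
    have h1 := hsum l
    rw [hXX, hsum', Function.update_of_ne hl, Function.update_of_ne hl, natCast_mul_val hd,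
      natCast_mul_val hd] at h1
    exact h1.symm
  refine ⟨?_, rfl, hu⟩
  funext l b
  have h1 := congrFun hXX (l, b)
  simp only [hX, hX', gridVertex] at h1
  by_cases hl : l = i
  · subst hl
    simpa using h1
  · simp only [Function.update_of_ne hl, hu l hl] at h1
    exact add_right_cancel h1

/-- Every edge of the large cube arises by stretching. -/
theorem exists_stretchedEdge (hd : Odd d) {e : Sym2 (Fin r × Fin d → ZMod 2)}
    (he : e ∈ (cube (Fin r × Fin d)).edgeSet) :
    ∃ κ : Fin r → Fin d → ZMod 2, (∀ l, ∑ b, κ l b = 0) ∧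
      ∃ u i, ∃ j < d, stretchedEdge κ u i j = e := by
  have h01 : ∀ b : ZMod 2, b = 0 ∨ b + 1 = 0 := by decide
  have key : ∀ (X : Fin r × Fin d → ZMod 2) i (j : Fin d),
      ∑ b, (X (i, b) + flips d j b) = 0 → ∃ κ : Fin r → Fin d → ZMod 2,
        (∀ l, ∑ b, κ l b = 0) ∧ ∃ u i', ∃ j' < d,
          stretchedEdge κ u i' j' = s(X, X + (Pi.single (i, j) 1 : Fin r × Fin d → ZMod 2)) := by
    intro X i j hX
    refine ⟨fun l b => X (l, b) + if l = i then flips d j b else ∑ b, X (l, b), ?_,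
      fun l => ∑ b, X (l, b), i, j, j.2, ?_⟩
    · intro l
      by_cases hl : l = i
      · subst hl
        simpa using hX
      · simp only [hl, if_false, Finset.sum_add_distrib, Finset.sum_const, Finset.card_univ,
          Fintype.card_fin, nsmul_eq_mul, (ZMod.natCast_eq_one_iff_odd).2 hd, one_mul]
        exact CharTwo.add_self_eq_zero _
    · rw [stretchedEdge_eq _ _ _ j.2]
      have : gridVertex (fun l b => X (l, b) + if l = i then flips d j b else ∑ b, X (l, b))
          (Function.update (fun l => d * (∑ b, X (l, b)).val) i j) = X := by
        funext ⟨l, b⟩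
        by_cases hl : l = i
        · subst hl
          simp [gridVertex, add_assoc, CharTwo.add_self_eq_zero]
        · simp [gridVertex, hl, flips_mul_val, add_assoc, CharTwo.add_self_eq_zero]
      rw [this]
  induction e with
  | _ X Y =>
  obtain ⟨⟨i, j⟩, hY⟩ := cube.adj_iff.1 he
  obtain rfl : Y = X + Pi.single (i, j) 1 := hY
  rcases h01 (∑ b, (X (i, b) + flips d j b)) with h | h
  · exact key X i j h
  · have hsw : s(X, X + Pi.single (i, j) 1) =
        s(X + Pi.single (i, j) 1, X + Pi.single (i, j) 1 + Pi.single (i, j) 1) := by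
      rw [add_add_self]
      exact Sym2.eq_swap
    rw [hsw]
    refine key _ i j ?_
    rw [← h]
    simp only [Pi.add_apply, Finset.sum_add_distrib, Pi.single_apply, Prod.mk.injEq, true_and,
      Finset.sum_ite_eq', Finset.mem_univ, if_true]
    ring

/-- The grid path obtained from a path `p` in `Q_r` by linear interpolation: it takes `d` unit
steps for every step of `p`. -/
def interpolate (d : ℕ) (p : ℕ → Fin r → ZMod 2) (t : ℕ) (l : Fin r) : ℕ :=
  (d - t % d) * (p (t / d) l).val + (t % d) * (p (t / d + 1) l).val

theorem interpolate_mul_add (p : ℕ → Fin r → ZMod 2) {a s : ℕ} (hd : 0 < d) (hs : s ≤ d)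
    {i : Fin r} (hp : p (a + 1) = p a + Pi.single i 1) :
    interpolate d p (d * a + s) =
      Function.update (fun l => d * (p a l).val) i (if p a i = 0 then s else d - s) := by
  have h01 : p a i = 0 ∨ p a i = 1 := by
    generalize p a i = x
    revert x
    decide
  have h1 : (1 + 1 : ZMod 2) = 0 := by decide
  have key : interpolate d p (d * a + s) =
      fun l => (d - s) * (p a l).val + s * (p (a + 1) l).val := by
    funext l
    unfold interpolate
    rcases hs.eq_or_lt with rfl | hs
    · rw [← Nat.mul_succ, Nat.mul_mod_right, Nat.mul_div_cancel_left _ hd]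
      simp
    · rw [Nat.mul_add_mod, Nat.mod_eq_of_lt hs, Nat.mul_add_div hd, Nat.div_eq_of_lt hs, add_zero]
  rw [key, hp]
  funext l
  by_cases hl : l = i
  · subst hl
    rcases h01 with h | h
    · simp [h, ZMod.val_one]
    · simp [h, h1, ZMod.val_one]
  · simp only [Pi.add_apply, Pi.single_eq_of_ne hl, add_zero, Function.update_of_ne hl]
    rw [← add_mul, Nat.sub_add_cancel hs]

theorem stretchedEdge_of_interpolate (κ : Fin r → Fin d → ZMod 2) (p : ℕ → Fin r → ZMod 2) {a s : ℕ}
    (hs : s < d) {i : Fin r} (hp : p (a + 1) = p a + Pi.single i 1) :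
    s(gridVertex κ (interpolate d p (d * a + s)), gridVertex κ (interpolate d p (d * a + s + 1))) =
      stretchedEdge κ (p a) i (if p a i = 0 then s else d - 1 - s) := by
  rw [interpolate_mul_add p (by omega) hs.le hp, add_assoc,
    interpolate_mul_add p (by omega) hs hp]
  by_cases h : p a i = 0
  · simp only [h, if_true]
    rfl
  · simp only [h, if_false, stretchedEdge]
    rw [show d - (s + 1) = d - 1 - s by omega, show d - s = d - 1 - s + 1 by omega]
    exact Sym2.eq_swap

theorem interpolate_injOn {m : ℕ} (hd : 0 < d) {p : ℕ → Fin r → ZMod 2}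
    (hp : Set.InjOn p (Set.Iic m)) (hadj : ∀ a < m, (cube (Fin r)).Adj (p a) (p (a + 1))) :
    Set.InjOn (interpolate d p) (Set.Iic (d * m)) := by
  -- at a time that is not a multiple of `d`, exactly one coordinate is strictly between `0` and `d`
  have key : ∀ t ≤ d * m, (t % d = 0 ∧ ∀ l, interpolate d p t l = d * (p (t / d) l).val) ∨
      (t / d < m ∧ ∃ i, p (t / d + 1) = p (t / d) + Pi.single i 1 ∧
        interpolate d p t = Function.update (fun l => d * (p (t / d) l).val) i
          (if p (t / d) i = 0 then t % d else d - t % d) ∧ 0 < t % d) := by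
    intro t ht
    rcases Nat.eq_zero_or_pos (t % d) with h | h
    · refine Or.inl ⟨h, fun l => ?_⟩
      simp [interpolate, h]
    · have hlt : t / d < m := by
        by_contra hge
        have h1 := Nat.div_add_mod t d
        have h2 : d * m ≤ d * (t / d) := Nat.mul_le_mul_left d (by omega)
        omega
      obtain ⟨i, hi⟩ := cube.adj_iff.1 (hadj _ hlt)
      refine Or.inr ⟨hlt, i, hi, ?_, h⟩
      have := interpolate_mul_add p hd (Nat.mod_lt t hd).le hi
      rwa [Nat.div_add_mod] at this
  have hval : ∀ a b : ZMod 2, d * a.val = d * b.val → a = b := fun a b h =>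
    ZMod.val_injective 2 (Nat.eq_of_mul_eq_mul_left hd h)
  have hext : ∀ a : ZMod 2, d * a.val = 0 ∨ d * a.val = d := by
    intro a
    have := val_le_one a
    rcases (by omega : a.val = 0 ∨ a.val = 1) with h | h <;> simp [h]
  intro t ht t' ht' h
  have hmt := Nat.mod_lt t hd
  have hmt' := Nat.mod_lt t' hd
  have hdm := Nat.div_add_mod t d
  have hdm' := Nat.div_add_mod t' d
  rw [Set.mem_Iic] at ht ht'
  rcases key t ht with ⟨h1, h2⟩ | ⟨h1, i, h2, h3, h4⟩ <;>
  rcases key t' ht' with ⟨h1', h2'⟩ | ⟨h1', i', h2', h3', h4'⟩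
  · have h3 : p (t / d) = p (t' / d) := by
      funext l
      exact hval _ _ (by rw [← h2, ← h2', h])
    have h4 := hp (Nat.div_le_of_le_mul ht) (Nat.div_le_of_le_mul ht') h3
    rw [h4] at hdm
    omega
  · have h5 := congrFun h i'
    rw [h2, h3', Function.update_self] at h5
    have := hext (p (t / d) i')
    split_ifs at h5 <;> omega
  · have h5 := congrFun h i
    rw [h2', h3, Function.update_self] at h5
    have := hext (p (t' / d) i)
    split_ifs at h5 <;> omega
  · rw [h3, h3'] at h
    obtain rfl : i = i' := by
      by_contra hne
      have h5 := congrFun h i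
      rw [Function.update_self, Function.update_of_ne hne] at h5
      have := hext (p (t' / d) i)
      split_ifs at h5 <;> omega
    have hoff : ∀ l, l ≠ i → p (t / d) l = p (t' / d) l := by
      intro l hl
      have h5 := congrFun h l
      rw [Function.update_of_ne hl, Function.update_of_ne hl] at h5
      exact hval _ _ h5
    -- the two segments have the same ends, so they coincide
    have hA : t / d = t' / d ∨ t / d = t' / d + 1 := by
      rcases eq_or_eq_add_single hoff with h5 | h5
      · exact Or.inl (hp h1.le h1'.le h5)
      · exact Or.inr (hp h1.le h1' (by rw [h5, h2']))
    have hB : t' / d = t / d ∨ t' / d = t / d + 1 := by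
      rcases eq_or_eq_add_single (fun l hl => (hoff l hl).symm) with h5 | h5
      · exact Or.inl (hp h1'.le h1.le h5)
      · exact Or.inr (hp h1'.le h1 (by rw [h5, h2]))
    have hC : t / d = t' / d := by omega
    have h5 := congrFun h i
    rw [Function.update_self, Function.update_self, hC] at h5
    rw [hC] at hdm
    split_ifs at h5 <;> omega

theorem interpolate_le (hd : 0 < d) (p : ℕ → Fin r → ZMod 2) (t : ℕ) (l : Fin r) :
    interpolate d p t l ≤ d := by
  have h1 := val_le_one (p (t / d) l)
  have h2 := val_le_one (p (t / d + 1) l)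
  calc interpolate d p t l ≤ (d - t % d) * 1 + t % d * 1 :=
        Nat.add_le_add (Nat.mul_le_mul_left _ h1) (Nat.mul_le_mul_left _ h2)
    _ = d := by
        have := Nat.mod_lt t hd
        omega

theorem gridVertex_inj {κ : Fin r → Fin d → ZMod 2} {θ θ' : Fin r → ℕ} (hθ : ∀ l, θ l ≤ d)
    (hθ' : ∀ l, θ' l ≤ d) (h : gridVertex κ θ = gridVertex κ θ') : θ = θ' := by
  funext l
  refine flips_injOn d (hθ l) (hθ' l) (funext fun b => ?_)
  exact add_left_cancel (congrFun h (l, b))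

/-- If `Q_r` decomposes into paths of length `m` and `d` is odd, then `Q_{d r}` decomposes into
paths of length `d * m`. Indeed `Q_d` is an edge-disjoint union of paths of length `d` from the
even vertices to their antipodes, so `Q_{d r}` is an edge-disjoint union of copies of `Q_r` in
which every edge has been replaced by a path of length `d`. -/
theorem PathDecomposable.stretch {m : ℕ} (hd : Odd d)
    (h : PathDecomposable m (cube (Fin r)).edgeSet) :
    PathDecomposable (d * m) (cube (Fin r × Fin d)).edgeSet := by
  have hd0 : 0 < d := hd.pos
  obtain ⟨S, hS, hSd, hSu⟩ := h
  choose p hp hpF using fun F : S => hS F.1 F.2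
  have hadj : ∀ F, ∀ a < m, (cube (Fin r)).Adj (p F a) (p F (a + 1)) := by
    intro F a ha
    rw [← SimpleGraph.mem_edgeSet, ← hSu]
    exact ⟨F.1, F.2, by rw [hpF F]; exact ⟨a, ha, rfl⟩⟩
  have htime : ∀ t < d * m, t / d < m ∧ t % d < d := fun t ht =>
    ⟨Nat.div_lt_of_lt_mul ht, Nat.mod_lt t hd0⟩
  have hedge : ∀ (κ : Fin r → Fin d → ZMod 2) F, ∀ t < d * m, ∃ i, ∃ j < d,
      p F (t / d + 1) = p F (t / d) + Pi.single i 1 ∧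
      s(gridVertex κ (interpolate d (p F) t), gridVertex κ (interpolate d (p F) (t + 1))) =
        stretchedEdge κ (p F (t / d)) i j := by
    intro κ F t ht
    obtain ⟨h1, h2⟩ := htime t ht
    obtain ⟨i, hi⟩ := cube.adj_iff.1 (hadj F _ h1)
    have h3 := stretchedEdge_of_interpolate κ (p F) h2 hi
    rw [Nat.div_add_mod] at h3
    exact ⟨i, _, by split_ifs <;> omega, hi, h3⟩
  refine of_family (ι := {κ : Fin r → Fin d → ZMod 2 // ∀ l, ∑ b, κ l b = 0} × S)
    (fun x t => gridVertex x.1.1 (interpolate d (p x.2) t)) ?_ ?_ ?_ ?_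
  · rintro ⟨κ, F⟩ t ht t' ht' heq
    exact interpolate_injOn hd0 (hp F) (hadj F) ht ht'
      (gridVertex_inj (interpolate_le hd0 _ _) (interpolate_le hd0 _ _) heq)
  · rintro ⟨κ, F⟩ t ht
    obtain ⟨i, j, hj, -, h⟩ := hedge κ.1 F t ht
    rw [h, stretchedEdge_eq _ _ _ hj, SimpleGraph.mem_edgeSet]
    exact cube.adj_iff.2 ⟨_, rfl⟩
  · intro e he
    obtain ⟨κ, hκ, u, i, j, hj, rfl⟩ := exists_stretchedEdge hd he
    have he' : s(u, u + Pi.single i 1) ∈ ⋃₀ S := by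
      rw [hSu]
      exact cube.adj_iff.2 ⟨i, rfl⟩
    obtain ⟨F, hF, huF⟩ := he'
    have huF' : s(u, u + Pi.single i 1) ∈ (⟨F, hF⟩ : S).1 := huF
    rw [hpF ⟨F, hF⟩] at huF'
    obtain ⟨a, ha, hau⟩ := huF'
    have hstep : p ⟨F, hF⟩ (a + 1) = p ⟨F, hF⟩ a + Pi.single i 1 ∧
        ∀ l, l ≠ i → p ⟨F, hF⟩ a l = u l := by
      rcases Sym2.eq_iff.1 hau with ⟨h1, h2⟩ | ⟨h1, h2⟩
      · exact ⟨by rw [h1, h2], fun l _ => by rw [h1]⟩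
      · exact ⟨by rw [h1, h2, add_add_self], fun l hl => by rw [h1]; simp [hl]⟩
    have hs : (if p ⟨F, hF⟩ a i = 0 then j else d - 1 - j) < d := by split_ifs <;> omega
    refine ⟨⟨⟨κ, hκ⟩, ⟨F, hF⟩⟩, d * a + _, ?_,
      (stretchedEdge_of_interpolate κ _ hs hstep.1).trans ?_⟩
    · calc d * a + _ < d * a + d := Nat.add_lt_add_left hs _
        _ = d * (a + 1) := (Nat.mul_succ d a).symm
        _ ≤ d * m := Nat.mul_le_mul_left d ha
    · rw [stretchedEdge_congr κ hstep.2]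
      congr 1
      split_ifs <;> omega
  · rintro ⟨κ, F⟩ ⟨κ', F'⟩ t ht t' ht' heq
    obtain ⟨i, j, hj, h1, h2⟩ := hedge κ.1 F t ht
    obtain ⟨i', j', hj', h1', h2'⟩ := hedge κ'.1 F' t' ht'
    obtain ⟨hκ, rfl, hu⟩ := stretchedEdge_inj hd κ.2 κ'.2 hj hj' (h2.symm.trans (heq.trans h2'))
    refine Prod.ext (Subtype.ext hκ) (Subtype.ext ?_)
    -- both members contain the edge that was stretched
    by_contra hne
    have hF : s(p F (t / d), p F (t / d + 1)) ∈ F.1 := by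
      rw [hpF F]
      exact ⟨_, (htime t ht).1, rfl⟩
    have hF' : s(p F (t / d), p F (t / d + 1)) ∈ F'.1 := by
      rw [hpF F']
      refine ⟨_, (htime t' ht').1, ?_⟩
      have h3 := eq_or_eq_add_single hu
      rw [h1, h1', Sym2.eq_iff]
      rcases h3 with h3 | h3
      · exact Or.inl ⟨h3.symm, by rw [h3]⟩
      · exact Or.inr ⟨by rw [h3, add_add_self], h3.symm⟩
    exact Set.disjoint_left.1 (hSd F.2 F'.2 hne) hF hF'

end Stretch

/-! ### The divisibility criterion -/

theorem theorem5 (q m : ℕ) (hq : Odd q) (hq32 : q < 2 ^ 32) :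
    GraphDivides (pathOfLength m) (hypercube q) ↔ m ≤ q ∧ m ∣ q * 2 ^ (q - 1) := by
  refine ⟨le_and_dvd_of_graphDivides hq, ?_⟩
  rintro ⟨hmq, hdvd⟩
  apply graphDivides_of_pathDecomposable
  have hm : m ≠ 0 := by
    rintro rfl
    have := hq.pos.ne'
    simp_all
  obtain ⟨k, d, hd, rfl⟩ := Nat.exists_eq_two_pow_mul_odd hm
  obtain ⟨r, rfl⟩ : d ∣ q :=
    (Nat.Coprime.pow_right _ hd.coprime_two_right).dvd_of_dvd_mul_right
      ((Dvd.intro_left _ rfl).trans hdvd)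
  have hr : Odd r := (Nat.odd_mul.1 hq).2
  have hkr : 2 ^ k ≤ r := by
    rw [mul_comm] at hmq
    exact Nat.le_of_mul_le_mul_left hmq hd.pos
  have h := (pathDecomposable_cube_two_pow k r hr hkr).stretch hd
  rw [mul_comm d] at h
  exact h.iso (cube.congr (finProdFinEquiv.trans (finCongr (mul_comm r d))))
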